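/- Let $k$ be a field, $n\ge 1$, and let $Q$ be the quiver $1\to 2\to\cdots\to n$ of type $A_n$. Let $D^b(A_n)=D^b(\operatorname{mod} kQ)$, where $\operatorname{mod} kQ$ is the category of finite dimensional right $kQ$-modules, i.e. of finite dimensional vector spaces $V_1,\dots,V_n$ with linear maps $V_{a+1}\to V_a$ ($1\le a<n$). For $1\le i\le j\le n$ let $M_{ij}$ be the module with $V_a=k$ for $i\le a\le j$, $V_a=0$ otherwise, and identity maps between the copies of $k$. Let $\sigma=(Z,\mathcal P)$ be a Bridgeland stability condition on $D^b(A_n)$ with the support property, and suppose that $\sigma$ is totally stable, i.e. every indecomposable object of $D^b(A_n)$ is stable (a simple object of $\mathcal P(\phi)$ for some $\phi\in\mathbb R$). The polygon $\mathbf P$ associated with $\sigma$ has the vertices $P_0,\dots,P_n\in\mathbb C$ given by $P_0=0$ and $$P_i=\frac{Z(M_{1i})}{Z(M_{11})}\qquad(1\le i\le n),$$ so that $P_1=1$; put $P_{n+1}=P_0$. Let $$\operatorname{gldim}\sigma=\sup\{\phi_2-\phi_1\mid \operatorname{Hom}(\mathcal P(\phi_1),\mathcal P(\phi_2))\ne 0\}$$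 be the global dimension of $\sigma$. Then $$\operatorname{gldim}\sigma=\frac1\pi\max\bigl\{\arg\overrightarrow{P_jP_i}-\arg\overrightarrow{P_{i+1}P_{j+1}}\ \bigm|\ 0\le i<j\le n\bigr\},$$ where the difference of arguments is the angle of the rotation from the direction of $\overrightarrow{P_{i+1}P_{j+1}}$ to that of $\overrightarrow{P_jP_i}$, taken in $(-\pi,\pi]$. -/

import Mathlib

open CategoryTheory CategoryTheory.Limits CategoryTheory.Pretriangulated
open scoped TensorProduct

universe w v u

noncomputable section

section Triangulated

variable (C : Type u) [Category.{v} C] [Preadditive C] [HasZeroObject C] [HasShift C ℤ]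
  [∀ n : ℤ, (shiftFunctor C n).Additive] [Pretriangulated C]

/-- The subgroup of the free abelian group on the objects generated by `[Y] - [X] - [Z]`, for all
distinguished triangles `X ⟶ Y ⟶ Z ⟶ X⟦1⟧`. -/
def triangleRelations : AddSubgroup (FreeAbelianGroup C) :=
  AddSubgroup.closure {x | ∃ T ∈ distTriang C, x = FreeAbelianGroup.of T.obj₂ -
    FreeAbelianGroup.of T.obj₁ - FreeAbelianGroup.of T.obj₃}

/-- The Grothendieck group `K(C)` of a triangulated category. -/
abbrev GrothendieckGroup : Type u := FreeAbelianGroup C ⧸ triangleRelations C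

variable {C} in
/-- The class `[E]` of an object in the Grothendieck group. -/
def classOf (E : C) : GrothendieckGroup C :=
  QuotientAddGroup.mk (FreeAbelianGroup.of E)

/-- A Bridgeland stability condition `(Z, P)` with the support property on a triangulated
category. -/
structure StabilityCondition where
  /-- The central charge. -/
  Z : GrothendieckGroup C →+ ℂ
  /-- The slicing: `P φ` is a (strictly) full additive subcategory for every phase `φ`. -/
  P : ℝ → ObjectProperty C
  prop_of_iso : ∀ (φ : ℝ) {X Y : C}, (X ≅ Y) → P φ X → P φ Y
  prop_zero : ∀ (φ : ℝ) {X : C}, IsZero X → P φ X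
  prop_biprod : ∀ (φ : ℝ) {X Y : C}, P φ X → P φ Y → P φ (X ⊞ Y)
  /-- `Z(E) ∈ ℝ_{>0} exp(iπφ)` for `0 ≠ E ∈ P(φ)`. -/
  central_charge : ∀ (φ : ℝ) (E : C), P φ E → ¬ IsZero E →
    ∃ m : ℝ, 0 < m ∧ Z (classOf E) = m * Complex.exp (Complex.I * Real.pi * φ)
  /-- `P(φ + 1) = P(φ)[1]`. -/
  shift : ∀ (φ : ℝ) (E : C), P (φ + 1) E ↔ ∃ F : C, P φ F ∧ Nonempty (E ≅ F⟦(1 : ℤ)⟧)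
  /-- `Hom(P(φ₁), P(φ₂)) = 0` for `φ₁ > φ₂`. -/
  hom_eq_zero : ∀ (φ₁ φ₂ : ℝ), φ₂ < φ₁ → ∀ (A₁ A₂ : C), P φ₁ A₁ → P φ₂ A₂ →
    ∀ f : A₁ ⟶ A₂, f = 0
  /-- Harder-Narasimhan filtrations: `0 = E₀ ⟶ E₁ ⟶ ⋯ ⟶ E_l = E`, with triangles
  `E_i ⟶ E_{i+1} ⟶ A_i ⟶ E_i[1]` and `A_i` in slices of strictly decreasing phases. -/
  hn_filtration : ∀ E : C, ¬ IsZero E →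
    ∃ (l : ℕ) (φ : Fin l → ℝ) (F : Fin (l + 1) → C) (A : Fin l → C),
      StrictAnti φ ∧ IsZero (F 0) ∧ Nonempty (F (Fin.last l) ≅ E) ∧
      ∀ i : Fin l, P (φ i) (A i) ∧
        ∃ (f : F i.castSucc ⟶ F i.succ) (g : F i.succ ⟶ A i)
          (h : A i ⟶ (F i.castSucc)⟦(1 : ℤ)⟧), Triangle.mk f g h ∈ distTriang C
  /-- The support property: for some norm on `K(C) ⊗ ℝ` and some constant `c > 0` one has
  `‖[E]‖ < c |Z(E)|` for all semistable `E`. -/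
  support : ∃ N : Seminorm ℝ (ℝ ⊗[ℤ] GrothendieckGroup C), (∀ x, N x = 0 → x = 0) ∧
    ∃ c : ℝ, 0 < c ∧ ∀ (φ : ℝ) (E : C), P φ E → ¬ IsZero E →
      N (1 ⊗ₜ classOf E) < c * ‖Z (classOf E)‖

namespace StabilityCondition

variable {C} (σ : StabilityCondition C)

/-- An object is stable if, for some `φ`, it is a simple object of the category `P(φ)`. -/
def IsStable (E : C) : Prop :=
  ∃ (φ : ℝ) (h : σ.P φ E), Simple (⟨E, h⟩ : (σ.P φ).FullSubcategory)

/-- `σ` is totally stable if every indecomposable object is stable. -/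
def IsTotallyStable : Prop := ∀ E : C, Indecomposable E → σ.IsStable E

/-- The global dimension
`sup {φ₂ - φ₁ | Hom(P(φ₁), P(φ₂)) ≠ 0}`, as an extended real number. -/
def gldim : EReal :=
  sSup {x | ∃ (φ₁ φ₂ : ℝ) (E₁ E₂ : C) (f : E₁ ⟶ E₂),
    σ.P φ₁ E₁ ∧ σ.P φ₂ E₂ ∧ f ≠ 0 ∧ x = ((φ₂ - φ₁ : ℝ) : EReal)}

end StabilityCondition

end Triangulated

section BoundedDerived

variable (A : Type u) [Category.{v} A] [Abelian A] [HasDerivedCategory.{w} A]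

/-- The bounded derived category `D^b(A)`: the full triangulated subcategory of the derived
category on the complexes with bounded cohomology. -/
abbrev BoundedDerivedCategory :=
  (DerivedCategory.TStructure.t (C := A)).bounded.FullSubcategory

variable {A} in
/-- An object of `A`, seen in `D^b(A)` as a complex concentrated in degree `0`. -/
def BoundedDerivedCategory.ofObj (X : A) : BoundedDerivedCategory A :=
  ⟨(DerivedCategory.singleFunctor A 0).obj X, ⟨0, inferInstance⟩, ⟨0, inferInstance⟩⟩

end BoundedDerived

/-- The set of vertices of the quiver `1 → 2 → ⋯ → n`; the element `a : Fin n` stands for the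
vertex with label `a + 1`. -/
def LinearQuiver (n : ℕ) : Type := Fin n

/-- The label, in `{1, …, n}`, of a vertex. -/
def LinearQuiver.label {n : ℕ} (a : LinearQuiver n) : ℕ := Fin.val a + 1

/-- There is exactly one arrow from `a` to `a + 1`, for `1 ≤ a < n`, and no other arrow. -/
instance (n : ℕ) : Quiver (LinearQuiver n) where
  Hom a b := PLift (a.label + 1 = b.label)

section TypeA

variable (k : Type u) [Field k] (n : ℕ)

/-- The category `mod kQ` of finite dimensional right modules over the path algebra `kQ` of
`Q = (1 → 2 → ⋯ → n)`, that is, of contravariant functors from the path category of `Q` to finite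
dimensional vector spaces: spaces `V_1, …, V_n` with linear maps `V_{a+1} ⟶ V_a`. -/
abbrev ModA := (Paths (LinearQuiver n))ᵒᵖ ⥤ FGModuleCat.{u} k

variable {n} in
/-- The vector space of `M_{ij}` at the vertex `a`: functions on a one-point set (so `k`) if
`i ≤ a ≤ j`, and functions on the empty set (so `0`) otherwise. -/
abbrev intervalSpace (i j : ℕ) (a : LinearQuiver n) : Type u :=
  PLift (i ≤ a.label ∧ a.label ≤ j) → k

open Classical in
variable {n} in
/-- The linear map of `M_{ij}` from the vertex `b` to the vertex `a`: the identity of `k` if both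
vertices lie between `i` and `j`, and zero otherwise. -/
def intervalMap (i j : ℕ) (a b : LinearQuiver n) :
    intervalSpace k i j b →ₗ[k] intervalSpace k i j a where
  toFun x _ := if h : i ≤ b.label ∧ b.label ≤ j then x ⟨h⟩ else 0
  map_add' x y := by
    funext _
    by_cases h : i ≤ b.label ∧ b.label ≤ j <;> simp [h]
  map_smul' c x := by
    funext _
    by_cases h : i ≤ b.label ∧ b.label ≤ j <;> simp [h]

/-- The interval module `M_{ij}` of `Q = (1 → 2 → ⋯ → n)`: `k` at the vertices between `i` and `j`,
`0` elsewhere, with identity maps wherever possible. It is indecomposable for `1 ≤ i ≤ j ≤ n`, and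
zero for `j < i`. -/
def intervalModule (i j : ℕ) : ModA k n :=
  (Paths.lift
    { obj := fun a : LinearQuiver n => Opposite.op (FGModuleCat.of k (intervalSpace k i j a))
      map := fun {a b} _ => (FGModuleCat.ofHom (intervalMap k i j a b)).op }).leftOp

/-- The bounded derived category `D^b(A_n) = D^b(mod kQ)`. -/
abbrev DbA [HasDerivedCategory.{w} (ModA k n)] := BoundedDerivedCategory (ModA k n)

variable {k n} [HasDerivedCategory.{w} (ModA k n)]

/-- The vertices of the polygon associated with a stability condition `σ` on `D^b(A_n)`:
`P_i = Z(M_{1i})` for `0 ≤ i ≤ n` (so `P_0 = 0`) and `P_{n+1} = P_0`, after rescaling `σ` so that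
`Z(S_1) = 1`, where `S_1 = M_{11}`. -/
def polygonVertex (σ : StabilityCondition (DbA k n)) (i : ℕ) : ℂ :=
  if i ≤ n then
    σ.Z (classOf (BoundedDerivedCategory.ofObj (intervalModule k n 1 i))) /
      σ.Z (classOf (BoundedDerivedCategory.ofObj (intervalModule k n 1 1)))
  else 0

end TypeA

/-- The difference `arg z - arg w` of the arguments of two nonzero complex numbers, that is, the
angle of the rotation from the direction of `w` to the direction of `z`, taken in `(-π, π]`. -/
def argDiff (z w : ℂ) : ℝ := Complex.arg (z / w)

end

/-! For intervals M, put S M_{1j} = M_{jn} and S M_{ij} = M_{i-1,j-1}[1] for i ≥ 2; these are the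
values of the Serre functor, and nothing else of that functor is needed. The global dimension is the
maximum of phase(S M) - phase(M) over the finitely many intervals M, and these gaps are exactly the
angles of the polygon.

Upper bound (`IsPhase.exists_sub_le`): every object of D^b(A_n) is a summand of a sum of shifted
intervals (`id_mem_factorIdeal_of_bounded`), so a nonzero X ⟶ Y between semistable objects extends
to a nonzero M[e] ⟶ X ⟶ Y ⟶ N[e']. The phases increase along the outer maps, and the Hom and Ext¹
table of intervals (`degree_cases`) provides a nonzero N[e'] ⟶ (S M)[e], so the phase of N[e'] is at
most that of (S M)[e]. The bound is attained because Hom(M, S M) ≠ 0 (`IsPhase.serre_mem`).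

Angles: differences of vertices are central charges of intervals up to the common factor Z(M_{11}),
so each quotient of two sides or diagonals in the statement is Z(S M)/Z(M) (`IsPhase.angle_set_eq`).
Nonzero maps M ⟶ S M, and chains of such maps from S M to M[1], confine the gap to [0, 1]
(`IsPhase.le_serrePhase`, `IsPhase.serrePhase_le`), so the principal argument is π times the gap
with no multiple of 2π lost (`arg_div_of_phases`). -/

open Opposite

/-! ### Paths in the linear quiver -/

namespace LinearQuiver

variable {n : ℕ}

lemma label_le_of_path {a b : LinearQuiver n} (p : Quiver.Path a b) : a.label ≤ b.label := by
  induction p with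
  | nil => exact le_rfl
  | cons _ e ih => have := e.down; omega

lemma label_injective {a b : LinearQuiver n} (h : a.label = b.label) : a = b :=
  Fin.ext (by simpa [label] using h)

lemma one_le_label (a : LinearQuiver n) : 1 ≤ a.label := by simp [label]

lemma label_le (a : LinearQuiver n) : a.label ≤ n := a.isLt

/-- The vertex with a given label. -/
def ofLabel (i : ℕ) (h₁ : 1 ≤ i) (h₂ : i ≤ n) : LinearQuiver n := (⟨i - 1, by omega⟩ : Fin n)

@[simp]
lemma label_ofLabel (i : ℕ) (h₁ : 1 ≤ i) (h₂ : i ≤ n) : (ofLabel i h₁ h₂).label = i := by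
  simp only [label, ofLabel]
  omega

/-- Each arrow raises the label by one, so the target of a path determines its last arrow. The path
category is thus a linear order. -/
lemma path_eq {a b : LinearQuiver n} (p q : Quiver.Path a b) : p = q := by
  induction p with
  | nil =>
    cases q with
    | nil => rfl
    | cons q e =>
      have := label_le_of_path q
      have := e.down
      omega
  | @cons b c p e ih =>
    cases q with
    | nil =>
      have := label_le_of_path p
      have := e.down
      omega
    | @cons b' _ q e' =>
      have h₁ := e.down
      have h₂ := e'.down
      obtain rfl : b = b' := label_injective (by omega)
      rw [ih q, show e = e' from PLift.down_injective (Subsingleton.elim _ _)]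

lemma nonempty_path {a b : LinearQuiver n} (h : a.label ≤ b.label) :
    Nonempty (Quiver.Path a b) := by
  obtain ⟨d, hd⟩ := Nat.exists_eq_add_of_le h
  induction d generalizing b with
  | zero =>
    obtain rfl : a = b := label_injective (by omega)
    exact ⟨.nil⟩
  | succ d ih =>
    have hb := b.label_le
    have ha := a.one_le_label
    obtain ⟨p⟩ := ih (b := ofLabel (a.label + d) (by omega) (by omega)) (by simp) (by simp)
    exact ⟨p.cons ⟨by simp; omega⟩⟩

instance (a b : Paths (LinearQuiver n)) : Subsingleton (a ⟶ b) := ⟨fun p q => path_eq p q⟩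

/-- The path from `a` to `b`. -/
noncomputable def path {a b : LinearQuiver n} (h : a.label ≤ b.label) :
    ((show Paths (LinearQuiver n) from a) ⟶ (show Paths (LinearQuiver n) from b)) :=
  (nonempty_path h).some

end LinearQuiver

/-! ### Representations in terms of their components -/

namespace ModA

open LinearQuiver

variable {k : Type u} [Field k] {n : ℕ}

/-- The vector space at a vertex. -/
abbrev space (V : ModA k n) (a : LinearQuiver n) : FGModuleCat.{u} k :=
  V.obj (op (show Paths (LinearQuiver n) from a))

/-- The structure map of a representation from a vertex to a vertex with a smaller label. -/
noncomputable def tr (V : ModA k n) {a b : LinearQuiver n} (h : a.label ≤ b.label) :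
    V.space b →ₗ[k] V.space a :=
  (V.map (path h).op).hom.hom

/-- The component of a morphism of representations. -/
noncomputable def comp {V W : ModA k n} (f : V ⟶ W) (a : LinearQuiver n) :
    V.space a →ₗ[k] W.space a :=
  (f.app (op (show Paths (LinearQuiver n) from a))).hom.hom

lemma tr_self (V : ModA k n) {a : LinearQuiver n} (x : V.space a) : V.tr le_rfl x = x := by
  rw [tr, Subsingleton.elim (path (le_refl a.label)) (𝟙 _)]
  exact congrArg (fun g => g.hom.hom x) (V.map_id _)

lemma tr_tr (V : ModA k n) {a b c : LinearQuiver n} (h : a.label ≤ b.label)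
    (h' : b.label ≤ c.label) (x : V.space c) : V.tr h (V.tr h' x) = V.tr (h.trans h') x := by
  rw [tr, tr, tr, Subsingleton.elim (path (h.trans h')) (path h ≫ path h')]
  exact (congrArg (fun g => g.hom.hom x) (V.map_comp (path h').op (path h).op)).symm

lemma comp_tr {V W : ModA k n} (f : V ⟶ W) {a b : LinearQuiver n} (h : a.label ≤ b.label)
    (x : V.space b) : comp f a (V.tr h x) = W.tr h (comp f b x) := by
  have := f.naturality (path h).op
  exact congrArg (fun g => g.hom.hom x) this

lemma hom_ext {V W : ModA k n} {f g : V ⟶ W} (h : ∀ a x, comp f a x = comp g a x) : f = g := by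
  ext a x
  exact h _ _

/-- A morphism of representations from its components. -/
noncomputable def mkHom {V W : ModA k n} (f : ∀ a, V.space a →ₗ[k] W.space a)
    (hf : ∀ {a b : LinearQuiver n} (h : a.label ≤ b.label) (x : V.space b),
      f a (V.tr h x) = W.tr h (f b x)) : V ⟶ W where
  app a := FGModuleCat.ofHom (f a.unop)
  naturality a b p := by
    obtain ⟨p, rfl⟩ : ∃ q, p = Quiver.Hom.op q := ⟨p.unop, rfl⟩
    ext x
    have := hf (label_le_of_path p) x
    unfold tr at this
    rw [Subsingleton.elim (path (label_le_of_path p)) p] at this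
    exact this

@[simp]
lemma comp_comp {V W X : ModA k n} (f : V ⟶ W) (g : W ⟶ X) (a : LinearQuiver n)
    (x : V.space a) : comp (f ≫ g) a x = comp g a (comp f a x) := rfl

@[simp]
lemma comp_id {V : ModA k n} (a : LinearQuiver n) (x : V.space a) : comp (𝟙 V) a x = x := rfl

@[simp]
lemma comp_zero {V W : ModA k n} (a : LinearQuiver n) (x : V.space a) :
    comp (0 : V ⟶ W) a x = 0 := rfl

/-! ### Interval modules and the morphisms between them -/

open Classical in
lemma intervalMap_apply (i j : ℕ) (a b : LinearQuiver n) (x : intervalSpace k i j b)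
    (h : PLift (i ≤ a.label ∧ a.label ≤ j)) :
    intervalMap k i j a b x h = if h : i ≤ b.label ∧ b.label ≤ j then x ⟨h⟩ else 0 :=
  rfl

lemma intervalMap_self (i j : ℕ) (a : LinearQuiver n) (x : intervalSpace k i j a) :
    intervalMap k i j a a x = x := by
  funext h
  rw [intervalMap_apply, dif_pos h.down]

lemma intervalMap_intervalMap (i j : ℕ) {a b c : LinearQuiver n} (h : a.label ≤ b.label)
    (h' : b.label ≤ c.label) (x : intervalSpace k i j c) :
    intervalMap k i j a b (intervalMap k i j b c x) = intervalMap k i j a c x := by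
  funext h''
  have := h''.down
  simp only [intervalMap_apply]
  split_ifs <;> first | rfl | omega

lemma interval_map (i j : ℕ) {a b : Paths (LinearQuiver n)} (p : a ⟶ b) :
    (intervalModule k n i j).map p.op = FGModuleCat.ofHom (intervalMap k i j a b) := by
  induction p using Paths.induction_fixed_source with
  | id =>
    rw [op_id, CategoryTheory.Functor.map_id]
    ext x
    exact (intervalMap_self i j a x).symm
  | comp p e ih =>
    rw [op_comp, CategoryTheory.Functor.map_comp, ih]
    have he : (intervalModule k n i j).map ((Paths.of _).map e).op =
        FGModuleCat.ofHom (intervalMap k i j _ _) :=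
      congrArg Quiver.Hom.unop (Paths.lift_toPath
        { obj := fun a : LinearQuiver n => op (FGModuleCat.of k (intervalSpace k i j a))
          map := fun {a b} _ => (FGModuleCat.ofHom (intervalMap k i j a b)).op } e)
    rw [he]
    ext x
    exact intervalMap_intervalMap i j (label_le_of_path p)
      (Nat.le_of_succ_le (le_of_eq e.down)) x

/-- The coordinate of an element of an interval module at a vertex. -/
noncomputable def coord (i j : ℕ) (a : LinearQuiver n) :
    (intervalModule k n i j).space a →ₗ[k] k where
  toFun x := open Classical in
    if h : i ≤ a.label ∧ a.label ≤ j then (show intervalSpace k i j a from x) ⟨h⟩ else 0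
  map_add' x y := by
    split_ifs
    · rfl
    · simp
  map_smul' c x := by
    split_ifs
    · rfl
    · simp

/-- The element with a given coordinate. -/
def elt (i j : ℕ) (a : LinearQuiver n) : k →ₗ[k] (intervalModule k n i j).space a :=
  show k →ₗ[k] intervalSpace k i j a from LinearMap.pi fun _ => LinearMap.id

lemma coord_of_mem {i j : ℕ} {a : LinearQuiver n} (h : i ≤ a.label ∧ a.label ≤ j)
    (x : (intervalModule k n i j).space a) :
    coord i j a x = (show intervalSpace k i j a from x) ⟨h⟩ := dif_pos h

@[simp]
lemma elt_coord (i j : ℕ) (a : LinearQuiver n) (x : (intervalModule k n i j).space a) :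
    elt i j a (coord i j a x) = x := by
  refine funext fun h => ?_
  exact coord_of_mem h.down x

lemma coord_elt {i j : ℕ} {a : LinearQuiver n} (h₁ : i ≤ a.label) (h₂ : a.label ≤ j) (c : k) :
    coord i j a (elt i j a c) = c := coord_of_mem ⟨h₁, h₂⟩ _

lemma coord_injective (i j : ℕ) (a : LinearQuiver n) :
    Function.Injective (coord (k := k) i j a) :=
  Function.LeftInverse.injective (elt_coord i j a)

lemma eq_zero_of_not_mem {i j : ℕ} {a : LinearQuiver n} (h : ¬ (i ≤ a.label ∧ a.label ≤ j))
    (x : (intervalModule k n i j).space a) : x = 0 :=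
  coord_injective i j a (by rw [map_zero]; exact dif_neg h)

lemma tr_elt {i j : ℕ} {a b : LinearQuiver n} (h : a.label ≤ b.label) (hb : b.label ≤ j) (c : k) :
    (intervalModule k n i j).tr h (elt i j b c) = elt i j a c := by
  rw [tr, interval_map]
  refine funext fun h' => ?_
  exact dif_pos ⟨h'.down.1.trans h, hb⟩

lemma coord_tr {i j : ℕ} {a b : LinearQuiver n} (h : a.label ≤ b.label) (ha : i ≤ a.label)
    (x : (intervalModule k n i j).space b) :
    coord i j a ((intervalModule k n i j).tr h x) = coord i j b x := by
  by_cases hb : b.label ≤ j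
  · rw [← elt_coord i j b x, tr_elt h hb, coord_elt ha (h.trans hb),
      coord_elt (ha.trans h) hb]
  · rw [eq_zero_of_not_mem (fun h' => hb h'.2) x]
    simp

/-- The morphism from an interval module given by an element at its top vertex. -/
noncomputable def fromInterval {V : ModA k n} (i : ℕ) {j : ℕ} {b : LinearQuiver n}
    (hb : b.label = j) (x : V.space b)
    (hx : ∀ (a : LinearQuiver n) (h : a.label ≤ b.label), a.label < i → V.tr h x = 0) :
    intervalModule k n i j ⟶ V :=
  -- The value 0 is forced: above `b` the source vanishes.
  mkHom (fun a => if h : a.label ≤ b.label then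
      (coord i j a).smulRight (V.tr h x) else 0) (by
    intro a c h y
    by_cases hc : c.label ≤ b.label
    · rw [dif_pos (h.trans hc), dif_pos hc]
      simp only [LinearMap.smulRight_apply, map_smul, tr_tr]
      by_cases ha : i ≤ a.label
      · rw [coord_tr h ha]
      · rw [hx a (h.trans hc) (by omega), smul_zero, smul_zero]
    · rw [eq_zero_of_not_mem (by omega) y]
      simp)

lemma fromInterval_elt {V : ModA k n} {i : ℕ} {j : ℕ} {b : LinearQuiver n}
    (hb : b.label = j) (x : V.space b)
    (hx : ∀ (a : LinearQuiver n) (h : a.label ≤ b.label), a.label < i → V.tr h x = 0)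
    (hij : i ≤ j) :
    comp (fromInterval i hb x hx) b (elt i j b 1) = x := by
  refine (LinearMap.congr_fun (dif_pos le_rfl) _).trans ?_
  rw [LinearMap.smulRight_apply, coord_elt (by omega) (by omega), one_smul, tr_self]

lemma interval_hom_ext {V : ModA k n} {i j : ℕ} {b : LinearQuiver n} (hb : b.label = j)
    {f g : intervalModule k n i j ⟶ V} (h : comp f b (elt i j b 1) = comp g b (elt i j b 1)) :
    f = g := by
  refine hom_ext fun a x => ?_
  by_cases ha : i ≤ a.label ∧ a.label ≤ j
  · have hab : a.label ≤ b.label := by omega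
    obtain ⟨c, rfl⟩ : ∃ c : k, x = elt i j a c := ⟨_, (elt_coord i j a x).symm⟩
    rw [← tr_elt hab hb.le, comp_tr, comp_tr, ← mul_one c, ← smul_eq_mul, map_smul,
      map_smul (comp f b), map_smul (comp g b), h]
  · rw [eq_zero_of_not_mem ha x, map_zero, map_zero]

/-- The morphism to an interval module given by a linear form at its bottom vertex. -/
noncomputable def toInterval {V : ModA k n} {i : ℕ} (j : ℕ) {c : LinearQuiver n}
    (hc : c.label = i) (ξ : V.space c →ₗ[k] k)
    (hξ : ∀ (b : LinearQuiver n) (h : c.label ≤ b.label) (x : V.space b), j < b.label →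
      ξ (V.tr h x) = 0) :
    V ⟶ intervalModule k n i j :=
  mkHom (fun a => if h : c.label ≤ a.label then elt i j a ∘ₗ ξ ∘ₗ V.tr h else 0) (by
    intro a b h x
    by_cases ha : c.label ≤ a.label
    · rw [dif_pos ha, dif_pos (ha.trans h)]
      simp only [LinearMap.comp_apply, tr_tr]
      by_cases hb : b.label ≤ j
      · rw [tr_elt h hb]
      · rw [hξ b (ha.trans h) x (by omega)]
        simp
    · have h' : ¬ (i ≤ a.label ∧ a.label ≤ j) := by omega
      exact (eq_zero_of_not_mem h' _).trans (eq_zero_of_not_mem h' _).symm)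

lemma comp_toInterval {V : ModA k n} {i : ℕ} {j : ℕ} {c : LinearQuiver n}
    (hc : c.label = i) (ξ : V.space c →ₗ[k] k)
    (hξ : ∀ (b : LinearQuiver n) (h : c.label ≤ b.label) (x : V.space b), j < b.label →
      ξ (V.tr h x) = 0) {a : LinearQuiver n} (h : c.label ≤ a.label) (x : V.space a) :
    comp (toInterval j hc ξ hξ) a x = elt i j a (ξ (V.tr h x)) := by
  exact LinearMap.congr_fun (dif_pos h) _

variable (k n) in
/-- The canonical morphism from `M_{ij}` to `M_{i'j'}`. -/
noncomputable def intervalHom {i j i' j' : ℕ} (hi : i ≤ i') (hj : j ≤ j') :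
    intervalModule k n i j ⟶ intervalModule k n i' j' :=
  mkHom (fun a => elt i' j' a ∘ₗ coord i j a) (by
    intro a b h x
    simp only [LinearMap.comp_apply]
    by_cases ha : i' ≤ a.label
    · rw [coord_tr h (hi.trans ha)]
      by_cases hb : b.label ≤ j'
      · rw [tr_elt h hb]
      · rw [eq_zero_of_not_mem (by omega) x]
        simp
    · rw [eq_zero_of_not_mem (by omega) (elt i' j' a _),
        eq_zero_of_not_mem (by omega) (tr _ _ _)])

lemma coord_intervalHom {i j i' j' : ℕ} (hi : i ≤ i') (hj : j ≤ j') {a : LinearQuiver n}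
    (ha : i' ≤ a.label) (ha' : a.label ≤ j') (x : (intervalModule k n i j).space a) :
    coord i' j' a (comp (intervalHom k n hi hj) a x) = coord i j a x :=
  coord_elt ha ha' _

lemma intervalHom_ne_zero {i j i' j' : ℕ} (hi : i ≤ i') (hj : j ≤ j') (h : i' ≤ j)
    (h₁ : 1 ≤ j) (h₂ : j ≤ n) : intervalHom k n hi hj ≠ 0 := by
  intro h₀
  have := coord_intervalHom (k := k) hi hj (a := ofLabel j h₁ h₂) (by simpa) (by simpa)
    (elt i j _ 1)
  rw [h₀, comp_zero, map_zero, coord_elt (by simpa using hi.trans h) (by simp)] at this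
  exact zero_ne_one this

/-- If `Hom(M_{ij}, M_{i'j'}) ≠ 0`, then `i ≤ i' ≤ j ≤ j'`. -/
lemma le_of_interval_hom_ne_zero {i j i' j' : ℕ} (h₁ : 1 ≤ i') (hij : i ≤ j) (hj₁ : 1 ≤ j)
    (hj : j ≤ n)
    {f : intervalModule k n i j ⟶ intervalModule k n i' j'} (hf : f ≠ 0) :
    i ≤ i' ∧ i' ≤ j ∧ j ≤ j' := by
  set b : LinearQuiver n := ofLabel j hj₁ hj with hb
  have hbj : b.label = j := by simp [hb]
  have hne : comp f b (elt i j b 1) ≠ 0 := fun h => hf (interval_hom_ext hbj h)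
  have hmem : i' ≤ b.label ∧ b.label ≤ j' := by
    by_contra h
    exact hne (eq_zero_of_not_mem h _)
  refine ⟨?_, by omega, by omega⟩
  -- If i' < i, carry the generator from `b` down to the vertex i': it dies in the source, while the
  -- structure map of the target is injective there.
  by_contra! hi
  have ha : (ofLabel (n := n) i' h₁ (by omega)).label ≤ b.label := by simp; omega
  have := comp_tr f ha (elt i j b 1)
  rw [eq_zero_of_not_mem (by simp; omega) (tr _ _ _), map_zero] at this
  have h' := congrArg (coord i' j' _) this
  rw [coord_tr ha (by simp), map_zero] at h'
  exact hne (coord_injective _ _ _ (by rw [map_zero, h']))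

/-- An endomorphism is determined by the scalar by which it acts on the generator, and a field has
no other idempotents than 0 and 1. -/
lemma idempotent_interval {i j : ℕ} (hj₁ : 1 ≤ j) (hj : j ≤ n) (hij : i ≤ j)
    (f : intervalModule k n i j ⟶ intervalModule k n i j) (hf : f ≫ f = f) :
    f = 0 ∨ f = 𝟙 _ := by
  set b : LinearQuiver n := ofLabel j hj₁ hj with hb
  have hbj : b.label = j := by simp [hb]
  obtain ⟨c, hc⟩ : ∃ c : k, comp f b (elt i j b 1) = elt i j b c := ⟨_, (elt_coord i j b _).symm⟩
  have hcc : c * c = c := by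
    have h : comp (f ≫ f) b (elt i j b 1) = comp f b (elt i j b 1) := by rw [hf]
    rw [comp_comp, hc, ← mul_one c, ← smul_eq_mul, map_smul, map_smul, hc, ← map_smul,
      ← map_smul] at h
    have := congrArg (coord i j b) h
    rw [coord_elt (by omega) (by omega), coord_elt (by omega) (by omega)] at this
    simpa using this
  rcases IsIdempotentElem.iff_eq_zero_or_one.mp hcc with rfl | rfl
  · exact .inl (interval_hom_ext hbj (by simpa using hc))
  · exact .inr (interval_hom_ext hbj (by simpa using hc))

/-! ### Exactness, projectives and short exact sequences of intervals -/

lemma comp_surjective {V W : ModA k n} (f : V ⟶ W) [Epi f] (a : LinearQuiver n) :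
    Function.Surjective (comp f a) := by
  have h : Epi ((forget₂ (FGModuleCat k) (ModuleCat k)).map (f.app (op a))) := inferInstance
  exact (ModuleCat.epi_iff_surjective _).mp h

lemma comp_injective {V W : ModA k n} (f : V ⟶ W) [Mono f] (a : LinearQuiver n) :
    Function.Injective (comp f a) := by
  have h : Mono ((forget₂ (FGModuleCat k) (ModuleCat k)).map (f.app (op a))) := inferInstance
  exact (ModuleCat.mono_iff_injective _).mp h

lemma epi_of_comp {V W : ModA k n} (f : V ⟶ W) (h : ∀ a, Function.Surjective (comp f a)) :
    Epi f := by
  rw [NatTrans.epi_iff_epi_app]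
  intro a
  exact ConcreteCategory.epi_of_surjective _ (h a.unop)

lemma mono_of_comp {V W : ModA k n} (f : V ⟶ W) (h : ∀ a, Function.Injective (comp f a)) :
    Mono f := by
  rw [NatTrans.mono_iff_mono_app]
  intro a
  exact ConcreteCategory.mono_of_injective _ (h a.unop)

/-- A morphism out of M_{1j} is an arbitrary element at the vertex j, since no vertex lies below 1
to impose a condition; elements lift along epimorphisms. -/
lemma projective_interval {j : ℕ} (hj₁ : 1 ≤ j) (hj : j ≤ n) :
    Projective (intervalModule k n 1 j) where
  factors {E X} f e _ := by
    set b : LinearQuiver n := ofLabel j hj₁ hj with hb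
    have hbj : b.label = j := by simp [hb]
    obtain ⟨y, hy⟩ := comp_surjective e b (comp f b (elt 1 j b 1))
    have hy' : ∀ (a : LinearQuiver n) (h : a.label ≤ b.label), a.label < 1 → E.tr h y = 0 := by
      intro a _ h
      have := a.one_le_label
      omega
    refine ⟨fromInterval 1 hbj y hy', interval_hom_ext hbj ?_⟩
    rw [comp_comp, fromInterval_elt hbj y hy' hj₁, hy]

variable (k n) in
/-- The short complex `M_{im} ⟶ M_{ij} ⟶ M_{m+1,j}`. -/
noncomputable def intervalShortComplex {i m j : ℕ} (h₁ : i ≤ m + 1) (h₂ : m ≤ j) :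
    ShortComplex (ModA k n) :=
  ShortComplex.mk (intervalHom k n le_rfl h₂) (intervalHom k n h₁ le_rfl) (by
    refine hom_ext fun a x => ?_
    by_cases ha : a.label ≤ m
    · exact (eq_zero_of_not_mem (by omega) _).trans (eq_zero_of_not_mem (by omega) _).symm
    · rw [eq_zero_of_not_mem (by omega) x, map_zero, map_zero])

lemma intervalShortComplex_shortExact {i m j : ℕ} (h₁ : i ≤ m + 1) (h₂ : m ≤ j) :
    (intervalShortComplex k n h₁ h₂).ShortExact := by
  have hf : ∀ a, Function.Injective (comp (intervalHom k n (le_refl i) h₂) a) := by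
    intro a x y hxy
    by_cases ha : i ≤ a.label ∧ a.label ≤ m
    · apply coord_injective
      rw [← coord_intervalHom le_rfl h₂ ha.1 (ha.2.trans h₂), hxy,
        coord_intervalHom le_rfl h₂ ha.1 (ha.2.trans h₂)]
    · rw [eq_zero_of_not_mem ha x, eq_zero_of_not_mem ha y]
  have hg : ∀ a, Function.Surjective (comp (intervalHom k n h₁ (le_refl j)) a) := by
    intro a x
    refine ⟨elt i j a (coord (m + 1) j a x), ?_⟩
    by_cases ha : m + 1 ≤ a.label ∧ a.label ≤ j
    · apply coord_injective
      rw [coord_intervalHom _ _ ha.1 ha.2, coord_elt (h₁.trans ha.1) ha.2]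
    · rw [eq_zero_of_not_mem ha x]
      exact eq_zero_of_not_mem ha _
  have : Mono (intervalShortComplex k n h₁ h₂).f := mono_of_comp _ hf
  have : Epi (intervalShortComplex k n h₁ h₂).g := epi_of_comp _ hg
  -- A morphism killed by the quotient map has zero coordinate above m, so reading its coordinate in
  -- M_{im} gives the factorization through the kernel.
  have key : ∀ {V : ModA k n} (u : V ⟶ intervalModule k n i j)
      (_ : u ≫ intervalHom k n h₁ (le_refl j) = 0) (a : LinearQuiver n) (x : V.space a),
      comp (intervalHom k n (le_refl i) h₂) a (elt i m a (coord i j a (comp u a x))) =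
        comp u a x := by
    intro V u hu a x
    by_cases ha : i ≤ a.label ∧ a.label ≤ j
    · apply coord_injective
      rw [coord_intervalHom _ _ ha.1 ha.2]
      by_cases ha' : a.label ≤ m
      · rw [coord_elt ha.1 ha']
      · rw [eq_zero_of_not_mem (by omega) (elt i m a _), map_zero,
          ← coord_intervalHom h₁ (le_refl j) (by omega) ha.2, ← comp_comp, hu, comp_zero,
          map_zero]
    · exact (eq_zero_of_not_mem ha _).trans (eq_zero_of_not_mem ha _).symm
  refine ⟨ShortComplex.exact_of_f_is_kernel _ (KernelFork.IsLimit.ofι' _ _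
    (fun {V} u hu => ⟨?_, ?_⟩))⟩
  · refine mkHom (W := intervalModule k n i m)
      (fun a => elt i m a ∘ₗ coord i j a ∘ₗ comp u a) fun {a b} h x => hf _ ?_
    have h₁ := key u hu a (V.tr h x)
    have h₂ := key u hu b x
    refine h₁.trans ((comp_tr u h x).trans ?_)
    rw [comp_tr]
    exact congrArg _ h₂.symm
  · exact hom_ext fun a x => key u hu a x

/-! ### Splitting off interval summands -/

instance : Fintype (LinearQuiver n) := inferInstanceAs (Fintype (Fin n))

/-- Every nonzero representation has an interval module as a direct summand. -/
lemma exists_interval_retract (V : ModA k n) (hV : ¬ IsZero V) :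
    ∃ (i j : ℕ) (_ : 1 ≤ i) (_ : i ≤ j) (_ : j ≤ n) (s : intervalModule k n i j ⟶ V)
      (r : V ⟶ intervalModule k n i j), s ≫ r = 𝟙 _ := by
  have h₀ : ∃ (a : LinearQuiver n) (x : V.space a), x ≠ 0 := by
    by_contra! h
    refine hV ((IsZero.iff_id_eq_zero _).mpr (hom_ext fun a x => ?_))
    rw [h a x, map_zero, map_zero]
  classical
  -- Take b maximal with V_b ≠ 0, then c minimal such that V_b ⟶ V_c is nonzero. Minimality of c
  -- lets x in V_b define a map from the interval [c, b]; maximality of b lets a linear form on V_c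
  -- define a map to it. Normalizing the form to be 1 on the image of x makes the composite the
  -- identity.
  obtain ⟨b, hb, hbmax⟩ := Finset.exists_max_image
    (Finset.univ.filter fun a : LinearQuiver n => ∃ x : V.space a, x ≠ 0) label
    (by obtain ⟨a, ha⟩ := h₀; exact ⟨a, by simpa using ha⟩)
  obtain ⟨c, hc, hcmin⟩ := Finset.exists_min_image
    (Finset.univ.filter fun a : LinearQuiver n => ∃ (h : a.label ≤ b.label) (x : V.space b),
      V.tr h x ≠ 0) label
    (by
      obtain ⟨x, hx⟩ := (Finset.mem_filter.mp hb).2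
      exact ⟨b, Finset.mem_filter.mpr ⟨Finset.mem_univ _, le_rfl, x, by rwa [tr_self]⟩⟩)
  obtain ⟨hcb, x, hx⟩ := (Finset.mem_filter.mp hc).2
  have hx' : ∀ (a : LinearQuiver n) (h : a.label ≤ b.label), a.label < c.label →
      V.tr h x = 0 := by
    intro a h hac
    by_contra hne
    have := hcmin a (Finset.mem_filter.mpr ⟨Finset.mem_univ _, h, x, hne⟩)
    omega
  obtain ⟨ξ, hξ⟩ : ∃ ξ : V.space c →ₗ[k] k, ξ (V.tr hcb x) = 1 := by
    obtain ⟨ξ, hξ⟩ := not_forall.mp (mt (Module.forall_dual_apply_eq_zero_iff k _).mp hx)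
    exact ⟨(ξ (V.tr hcb x))⁻¹ • ξ, inv_mul_cancel₀ hξ⟩
  have hξ' : ∀ (d : LinearQuiver n) (h : c.label ≤ d.label) (y : V.space d),
      b.label < d.label → ξ (V.tr h y) = 0 := by
    intro d h y hbd
    have : y = 0 := by
      by_contra hne
      have := hbmax d (Finset.mem_filter.mpr ⟨Finset.mem_univ _, y, hne⟩)
      omega
    rw [this, map_zero, map_zero]
  refine ⟨c.label, b.label, c.one_le_label, hcb, b.label_le, fromInterval c.label rfl x hx',
    toInterval b.label rfl ξ hξ', interval_hom_ext rfl ?_⟩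
  rw [comp_comp, fromInterval_elt rfl x hx' hcb, comp_toInterval rfl ξ hξ' hcb, hξ, comp_id]

/-- The total dimension of a representation. -/
noncomputable def dim (V : ModA k n) : ℕ := ∑ a : LinearQuiver n, Module.finrank k (V.space a)

lemma dim_kernel_lt {V W : ModA k n} {f : V ⟶ W} (hf : f ≠ 0) : dim (kernel f) < dim V := by
  have hle : ∀ a, Module.finrank k ((kernel f).space a) ≤ Module.finrank k (V.space a) :=
    fun a => LinearMap.finrank_le_finrank_of_injective (comp_injective (kernel.ι f) a)
  refine Finset.sum_lt_sum (fun a _ => hle a) ?_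
  by_contra! h
  refine hf (hom_ext fun a x => ?_)
  have hs := (LinearMap.injective_iff_surjective_of_finrank_eq_finrank
    ((hle a).antisymm (h a (Finset.mem_univ _)))).mp (comp_injective (kernel.ι f) a)
  obtain ⟨y, rfl⟩ := hs x
  rw [← comp_comp, kernel.condition, comp_zero, comp_zero]

end ModA

/-! ### Identities factoring through sums of objects of a given class -/

section FactorIdeal

variable {C : Type*} [Category* C] [Preadditive C]

/-- The finite sums of morphisms which factor through an object with a given property. -/
def factorIdeal (S : ObjectProperty C) (X Y : C) : AddSubgroup (X ⟶ Y) :=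
  AddSubgroup.closure {f | ∃ (M : C) (_ : S M) (a : X ⟶ M) (b : M ⟶ Y), f = a ≫ b}

variable {S : ObjectProperty C}

lemma factorIdeal_induction {X Y : C} {f : X ⟶ Y} (hf : f ∈ factorIdeal S X Y) {G : Type*}
    [AddGroup G] (φ : (X ⟶ Y) →+ G) (H : AddSubgroup G)
    (h : ∀ (M : C) (_ : S M) (a : X ⟶ M) (b : M ⟶ Y), φ (a ≫ b) ∈ H) : φ f ∈ H := by
  have : factorIdeal S X Y ≤ H.comap φ := by
    refine (AddSubgroup.closure_le _).mpr ?_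
    rintro _ ⟨M, hM, a, b, rfl⟩
    exact h M hM a b
  exact this hf

lemma comp_mem_factorIdeal {M X Y : C} (hM : S M) (a : X ⟶ M) (b : M ⟶ Y) :
    a ≫ b ∈ factorIdeal S X Y :=
  AddSubgroup.subset_closure ⟨M, hM, a, b, rfl⟩

lemma comp_comp_mem_factorIdeal {W X Y Z : C} {f : X ⟶ Y} (hf : f ∈ factorIdeal S X Y)
    (a : W ⟶ X) (b : Y ⟶ Z) : a ≫ f ≫ b ∈ factorIdeal S W Z :=
  factorIdeal_induction hf ((Preadditive.leftComp Z a).comp (Preadditive.rightComp X b)) _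
    fun M hM c d => by
      change a ≫ (c ≫ d) ≫ b ∈ _
      simpa using comp_mem_factorIdeal hM (a ≫ c) (d ≫ b)

lemma factorIdeal_mono {S' : ObjectProperty C} (h : S ≤ S') (X Y : C) :
    factorIdeal S X Y ≤ factorIdeal S' X Y :=
  AddSubgroup.closure_mono fun _ ⟨M, hM, a, b, e⟩ => ⟨M, h M hM, a, b, e⟩

lemma id_mem_factorIdeal_of_iso {X Y : C} (e : X ≅ Y) (h : 𝟙 X ∈ factorIdeal S X X) :
    𝟙 Y ∈ factorIdeal S Y Y := by
  simpa using comp_comp_mem_factorIdeal h e.inv e.hom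

/-- The substitute for decomposing Y as X ⊕ Z: membership of the identity says that an object is a
summand of a finite sum from `S`, without constructing the sum. -/
lemma id_mem_factorIdeal_of_eq_add {X Y Z : C} (hX : 𝟙 X ∈ factorIdeal S X X)
    (hZ : 𝟙 Z ∈ factorIdeal S Z Z) (p : Y ⟶ X) (i : X ⟶ Y) (q : Y ⟶ Z) (j : Z ⟶ Y)
    (h : 𝟙 Y = p ≫ i + q ≫ j) : 𝟙 Y ∈ factorIdeal S Y Y := by
  rw [h]
  have h₁ := comp_comp_mem_factorIdeal hX p i
  have h₂ := comp_comp_mem_factorIdeal hZ q j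
  rw [Category.id_comp] at h₁ h₂
  exact add_mem h₁ h₂

lemma map_id_mem_factorIdeal {D : Type*} [Category* D] [Preadditive D] (F : C ⥤ D) [F.Additive]
    {S' : ObjectProperty D} (hF : ∀ M, S M → S' (F.obj M)) {X : C}
    (h : 𝟙 X ∈ factorIdeal S X X) : 𝟙 (F.obj X) ∈ factorIdeal S' (F.obj X) (F.obj X) := by
  rw [← F.map_id]
  refine factorIdeal_induction h F.mapAddHom _ fun M hM a b => ?_
  rw [Functor.coe_mapAddHom, F.map_comp]
  exact comp_mem_factorIdeal (hF M hM) _ _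

/-- Otherwise f kills every map through an object of `S`, hence also the identity. -/
lemma exists_comp_ne_zero_of_source {X Y : C} (h : 𝟙 X ∈ factorIdeal S X X) {f : X ⟶ Y}
    (hf : f ≠ 0) : ∃ (M : C) (_ : S M) (a : M ⟶ X), a ≫ f ≠ 0 := by
  by_contra! H
  refine hf ?_
  have := factorIdeal_induction h (Preadditive.rightComp X f) ⊥ fun M hM a b => by
    change (a ≫ b) ≫ f = 0
    rw [Category.assoc, H M hM b, Limits.comp_zero]
  exact (Category.id_comp f).symm.trans this

lemma exists_comp_ne_zero_of_target {X Y : C} (h : 𝟙 Y ∈ factorIdeal S Y Y) {f : X ⟶ Y}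
    (hf : f ≠ 0) : ∃ (M : C) (_ : S M) (b : Y ⟶ M), f ≫ b ≠ 0 := by
  by_contra! H
  refine hf ?_
  have := factorIdeal_induction h (Preadditive.leftComp Y f) ⊥ fun M hM a b => by
    change f ≫ a ≫ b = 0
    rw [← Category.assoc, H M hM a, Limits.zero_comp]
  exact (Category.comp_id f).symm.trans this

end FactorIdeal

/-! ### Split triangles and shifts -/

section Triangle

variable {C : Type*} [Category* C] [Preadditive C] [HasShift C ℤ]
  [∀ n : ℤ, (shiftFunctor C n).Additive]

/-- A vanishing connecting morphism gives a section s of the second map, and 1 minus the resulting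
idempotent factors through the first object. -/
lemma id_mem_factorIdeal_of_distTriang [HasZeroObject C] [Pretriangulated C]
    {S : ObjectProperty C} {T : Triangle C}
    (hT : T ∈ distTriang C) (h : T.mor₃ = 0) (h₁ : 𝟙 T.obj₁ ∈ factorIdeal S T.obj₁ T.obj₁)
    (h₃ : 𝟙 T.obj₃ ∈ factorIdeal S T.obj₃ T.obj₃) :
    𝟙 T.obj₂ ∈ factorIdeal S T.obj₂ T.obj₂ := by
  obtain ⟨s, hs⟩ := T.coyoneda_exact₃ hT (𝟙 T.obj₃) (by rw [h, Limits.comp_zero])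
  obtain ⟨r, hr⟩ := T.coyoneda_exact₂ hT (𝟙 T.obj₂ - T.mor₂ ≫ s) (by
    rw [Preadditive.sub_comp, Category.assoc, ← hs, Category.id_comp, Category.comp_id, sub_self])
  exact id_mem_factorIdeal_of_eq_add h₁ h₃ r T.mor₁ T.mor₂ s (by rw [← hr]; abel)

lemma eq_zero_of_shift_source {X Y : C} (e : ℤ) (h : ∀ g : X ⟶ Y⟦-e⟧, g = 0) (f : X⟦e⟧ ⟶ Y) :
    f = 0 := by
  apply (shiftFunctor C (-e)).map_injective
  rw [Functor.map_zero, ← cancel_epi ((shiftShiftNeg X e).inv), h (_ ≫ _), Limits.comp_zero]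

end Triangle

/-! ### Vanishing of morphisms for degree reasons -/

section Derived

open DerivedCategory

variable {A : Type u} [Category.{v} A] [Abelian A] [HasDerivedCategory.{w} A]

lemma hom_eq_zero_of_projective_of_isLE {P : A} [Projective P] {X : DerivedCategory A} {m : ℤ}
    (hm : m < 0) [X.IsLE m] (f : (singleFunctor A 0).obj P ⟶ X) : f = 0 := by
  obtain ⟨L, _, ⟨e⟩⟩ := X.exists_iso_Q_obj_of_isLE m
  have := from_singleFunctor_obj_eq_zero_of_projective
    (((singleFunctorIsoCompQ A 0).app P).inv ≫ f ≫ e.hom) m hm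
  rw [← cancel_mono e.hom, ← cancel_epi ((singleFunctorIsoCompQ A 0).app P).inv, this]
  simp

lemma singleFunctor_shift_isLE (X : A) (m : ℤ) :
    (((singleFunctor A 0).obj X)⟦m⟧).IsLE (-m) :=
  TStructure.t.isLE_shift _ 0 m (-m)

lemma singleFunctor_shift_isGE (X : A) (m : ℤ) :
    (((singleFunctor A 0).obj X)⟦m⟧).IsGE (-m) :=
  TStructure.t.isGE_shift _ 0 m (-m)

end Derived

/-! ### Decomposition of complexes, and Hom and Ext¹ of intervals -/

namespace ModA

open DerivedCategory

variable {k : Type u} [Field k] {n : ℕ}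

variable (k n) in
/-- The interval modules. -/
def isInterval : ObjectProperty (ModA k n) := fun V =>
  ∃ i j : ℕ, 1 ≤ i ∧ i ≤ j ∧ j ≤ n ∧ V = intervalModule k n i j

/-- Split off one interval and induct on the dimension of the complement, which is the kernel of the
retraction. -/
lemma id_mem_factorIdeal_isInterval (V : ModA k n) :
    𝟙 V ∈ factorIdeal (isInterval k n) V V := by
  induction hd : dim V using Nat.strong_induction_on generalizing V with
  | _ d ih =>
    by_cases hV : IsZero V
    · rw [(IsZero.iff_id_eq_zero _).mp hV]
      exact zero_mem _
    obtain ⟨i, j, hi, hij, hj, s, r, hsr⟩ := exists_interval_retract V hV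
    have hM : isInterval k n (intervalModule k n i j) := ⟨i, j, hi, hij, hj, rfl⟩
    have hr : r ≠ 0 := by
      rintro rfl
      rw [Limits.comp_zero] at hsr
      exact intervalHom_ne_zero (k := k) (n := n) (le_refl i) (le_refl j) hij (hi.trans hij) hj
        (by rw [← Category.id_comp (intervalHom _ _ _ _), ← hsr, Limits.zero_comp])
    have hk := ih _ (hd ▸ dim_kernel_lt hr) (kernel r) rfl
    refine id_mem_factorIdeal_of_eq_add (X := intervalModule k n i j) (by
      simpa using comp_mem_factorIdeal hM (𝟙 _) (𝟙 _)) hk r s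
      (kernel.lift r (𝟙 V - r ≫ s) (by simp [hsr])) (kernel.ι r) (by simp)

/-- A morphism from M_{1i} is an element at the vertex i. Since j ≤ j', this element is the image of
one at the vertex j with the same coordinate. -/
lemma exists_extension {i j i' j' : ℕ} (hi : 1 ≤ i) (hij : i ≤ j) (hj : j ≤ n)
    (hj' : j ≤ j') (g : intervalModule k n 1 i ⟶ intervalModule k n i' j') :
    ∃ g' : intervalModule k n 1 j ⟶ intervalModule k n i' j',
      intervalHom k n (le_refl 1) hij ≫ g' = g := by
  set a : LinearQuiver n := LinearQuiver.ofLabel i hi (hij.trans hj) with ha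
  set b : LinearQuiver n := LinearQuiver.ofLabel j (hi.trans hij) hj with hb
  have hai : a.label = i := by simp [ha]
  have hbj : b.label = j := by simp [hb]
  have hab : a.label ≤ b.label := by omega
  obtain ⟨c, hc⟩ : ∃ c : k, comp g a (elt 1 i a 1) = elt i' j' a c :=
    ⟨_, (elt_coord i' j' a _).symm⟩
  have hx : ∀ (d : LinearQuiver n) (h : d.label ≤ b.label), d.label < 1 →
      (intervalModule k n i' j').tr h (elt i' j' b c) = 0 := by
    intro d _ h
    have := d.one_le_label
    omega
  refine ⟨fromInterval 1 hbj (elt i' j' b c) hx, interval_hom_ext hai ?_⟩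
  have h₁ : comp (intervalHom k n (le_refl 1) hij) a (elt 1 i a 1) =
      (intervalModule k n 1 j).tr hab (elt 1 j b 1) := by
    apply coord_injective
    rw [coord_intervalHom _ _ (by omega) (by omega), tr_elt hab hbj.le,
      coord_elt (by omega) (by omega), coord_elt (by omega) (by omega)]
  rw [comp_comp, h₁, comp_tr, fromInterval_elt hbj _ hx (by omega), tr_elt hab (by omega), hc]

variable [HasDerivedCategory.{w} (ModA k n)]

variable (k n) in
/-- The interval module `M_{ij}` in the derived category. -/
noncomputable abbrev single (i j : ℕ) : DerivedCategory (ModA k n) :=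
  (singleFunctor (ModA k n) 0).obj (intervalModule k n i j)

/-- The connecting morphism of the triangle `M_{1i} ⟶ M_{1,j+1} ⟶ M_{i+1,j+1} ⟶ M_{1i}[1]`. -/
lemma exists_connecting {i j : ℕ} (hij : i ≤ j) :
    ∃ δ : single k n (i + 1) (j + 1) ⟶ (single k n 1 i)⟦(1 : ℤ)⟧,
      (∀ (X : DerivedCategory (ModA k n)) (f : single k n (i + 1) (j + 1) ⟶ X),
        (singleFunctor _ 0).map (intervalHom k n (Nat.le_add_left 1 i) (le_refl (j + 1))) ≫ f = 0 →
          ∃ g : (single k n 1 i)⟦(1 : ℤ)⟧ ⟶ X, f = δ ≫ g) ∧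
      δ ≫ ((singleFunctor _ 0).map (intervalHom k n (le_refl 1)
        (hij.trans j.le_succ)))⟦(1 : ℤ)⟧' = 0 ∧
      ∀ (X : DerivedCategory (ModA k n)) (u : (single k n 1 i)⟦(1 : ℤ)⟧ ⟶ X), δ ≫ u = 0 →
        ∃ q : (single k n 1 (j + 1))⟦(1 : ℤ)⟧ ⟶ X, u = ((singleFunctor _ 0).map
          (intervalHom k n (le_refl 1) (hij.trans j.le_succ)))⟦(1 : ℤ)⟧' ≫ q := by
  have hT := (intervalShortComplex_shortExact (k := k) (n := n) (i := 1) (m := i) (j := j + 1)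
    (Nat.le_add_left 1 i) (hij.trans j.le_succ)).singleTriangle_distinguished
  refine ⟨_, fun X f hf => Triangle.yoneda_exact₃ _ hT f hf, comp_distTriang_mor_zero₃₁ _ hT,
    fun X u hu => ?_⟩
  obtain ⟨q, hq⟩ := Triangle.yoneda_exact₂ _ (rot_of_distTriang _ (rot_of_distTriang _ hT)) u hu
  -- The sign cancels the one that rotation puts on the shifted map.
  exact ⟨-q, hq.trans ((Preadditive.neg_comp _ _).trans (Preadditive.comp_neg _ _).symm)⟩

/-- The algebra is hereditary: 0 ⟶ M_{1i} ⟶ M_{1,j+1} ⟶ M_{i+1,j+1} ⟶ 0 is a projective resolution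
of length one, so the range of vanishing valid for projectives shrinks by only one degree. -/
lemma single_hom_eq_zero_of_isLE {i j : ℕ} (hi : 1 ≤ i) (hij : i ≤ j) (hj : j ≤ n)
    {X : DerivedCategory (ModA k n)} {m : ℤ} (hm : m < -1) [X.IsLE m] (f : single k n i j ⟶ X) :
    f = 0 := by
  have hP : ∀ (j : ℕ) (_ : 1 ≤ j) (_ : j ≤ n) {Y : DerivedCategory (ModA k n)} {m : ℤ}
      (_ : m < 0) [Y.IsLE m] (f : single k n 1 j ⟶ Y), f = 0 := by
    intro j h₁ h₂ Y m hm _ f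
    have := projective_interval (k := k) h₁ h₂
    exact hom_eq_zero_of_projective_of_isLE hm f
  obtain ⟨j, rfl⟩ : ∃ j', j = j' + 1 := ⟨j - 1, by omega⟩
  rcases hi.eq_or_lt with rfl | hi
  · exact hP _ hij hj (show m < 0 by omega) f
  obtain ⟨i, rfl⟩ : ∃ i', i = i' + 1 := ⟨i - 1, by omega⟩
  obtain ⟨δ, hδ, hδ', hδ''⟩ := exists_connecting (k := k) (n := n) (i := i) (j := j) (by omega)
  obtain ⟨g, rfl⟩ := hδ _ f (hP _ (by omega) hj (show m < 0 by omega) _)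
  have : (X⟦(-1 : ℤ)⟧).IsLE (m + 1) := TStructure.t.isLE_shift X m (-1) (m + 1)
  rw [eq_zero_of_shift_source 1 (hP i (by omega) (by omega) (show m + 1 < 0 by omega)) g]
  exact Limits.comp_zero

variable (k n) in
/-- The shifts `M_{ij}[e]` of interval modules. -/
def isShiftedInterval (e : ℤ) : ObjectProperty (DerivedCategory (ModA k n)) := fun X =>
  ∃ i j : ℕ, 1 ≤ i ∧ i ≤ j ∧ j ≤ n ∧ Nonempty ((single k n i j)⟦e⟧ ≅ X)

lemma id_mem_factorIdeal_singleFunctor (b : ℤ) (Y : ModA k n) :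
    𝟙 ((singleFunctor (ModA k n) b).obj Y) ∈ factorIdeal (isShiftedInterval k n (-b)) _ _ := by
  refine map_id_mem_factorIdeal _ ?_ (id_mem_factorIdeal_isInterval Y)
  rintro _ ⟨i, j, hi, hij, hj, rfl⟩
  exact ⟨i, j, hi, hij, hj,
    ⟨((singleFunctors (ModA k n)).shiftIso (-b) b 0 (neg_add_cancel b)).app _⟩⟩

/-- Induction on the number d of degrees allowed to carry cohomology. The triangle that cuts off the
top cohomology splits: its connecting morphism goes from a module in degree b to a complex in
degrees at most b - 2, where only extensions of degree at least 2 occur. -/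
lemma id_mem_factorIdeal_of_isGE_of_isLE (d : ℕ) (b : ℤ) (X : DerivedCategory (ModA k n))
    [X.IsLE b] [X.IsGE (b + 1 - d)] : 𝟙 X ∈ factorIdeal (⨆ e, isShiftedInterval k n e) X X := by
  induction d generalizing b X with
  | zero =>
    have : IsZero X := TStructure.t.isZero X b (b + 1 - (0 : ℕ)) (by simp)
    rw [(IsZero.iff_id_eq_zero _).mp this]
    exact zero_mem _
  | succ d ih =>
    have hT := TStructure.t.triangleLEGT_distinguished (b - 1) X
    have h₁ : (TStructure.t.truncLE (b - 1)).obj X |>.IsGE (b - 1 + 1 - d) := by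
      rw [show b - 1 + 1 - (d : ℤ) = b + 1 - (d + 1 : ℕ) by push_cast; ring]
      infer_instance
    have h₃ : (TStructure.t.truncGT (b - 1)).obj X |>.IsGE b := inferInstance
    have hW := ih (b - 1) ((TStructure.t.truncLE (b - 1)).obj X)
    obtain ⟨Y, ⟨e⟩⟩ := exists_iso_singleFunctor_obj_of_isGE_of_isLE
      ((TStructure.t.truncGT (b - 1)).obj X) b
    have hZ := id_mem_factorIdeal_of_iso e.symm (id_mem_factorIdeal_singleFunctor b Y)
    refine id_mem_factorIdeal_of_distTriang hT ?_ hW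
      (factorIdeal_mono (le_iSup (isShiftedInterval k n) (-b)) _ _ hZ)
    by_contra hne
    obtain ⟨M, ⟨i, j, hi, hij, hj, ⟨e'⟩⟩, a, ha⟩ := exists_comp_ne_zero_of_source hZ hne
    have : (((TStructure.t.truncLE (b - 1)).obj X)⟦(1 : ℤ)⟧).IsLE (b - 2) :=
      TStructure.t.isLE_shift _ (b - 1) 1 (b - 2)
    have : ((((TStructure.t.truncLE (b - 1)).obj X)⟦(1 : ℤ)⟧)⟦(- -b)⟧).IsLE (-2) :=
      TStructure.t.isLE_shift _ (b - 2) (- -b) (-2)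
    have h₀ := eq_zero_of_shift_source (Y := ((TStructure.t.truncLE (b - 1)).obj X)⟦(1 : ℤ)⟧) (-b)
      (fun g => single_hom_eq_zero_of_isLE hi hij hj (show (-2 : ℤ) < -1 by norm_num) g)
      (e'.hom ≫ a ≫ ((TStructure.t.triangleLEGT (b - 1)).obj X).mor₃)
    refine ha ?_
    rw [← cancel_epi e'.hom, Limits.comp_zero]
    exact h₀

/-- Every object of the bounded derived category is a direct summand of a finite direct sum of
shifts of interval modules. -/
lemma id_mem_factorIdeal_of_bounded (X : DerivedCategory (ModA k n))
    (hX : TStructure.t.bounded X) : 𝟙 X ∈ factorIdeal (⨆ e, isShiftedInterval k n e) X X := by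
  obtain ⟨⟨a, _⟩, ⟨b, _⟩⟩ := hX
  have : X.IsGE (b + 1 - (b + 1 - a).toNat) :=
    TStructure.t.isGE_of_ge X _ a (by have := Int.self_le_toNat (b + 1 - a); omega)
  exact id_mem_factorIdeal_of_isGE_of_isLE (b + 1 - a).toNat b X

lemma exists_shifted_interval_comp_ne_zero {X Y : DerivedCategory (ModA k n)}
    (hX : TStructure.t.bounded X) (hY : TStructure.t.bounded Y) {f : X ⟶ Y} (hf : f ≠ 0) :
    ∃ (i j i' j' : ℕ) (e e' : ℤ) (_ : 1 ≤ i ∧ i ≤ j ∧ j ≤ n) (_ : 1 ≤ i' ∧ i' ≤ j' ∧ j' ≤ n)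
      (a : (single k n i j)⟦e⟧ ⟶ X) (b : Y ⟶ (single k n i' j')⟦e'⟧), a ≫ f ≫ b ≠ 0 := by
  obtain ⟨M, hM, a, ha⟩ := exists_comp_ne_zero_of_source (id_mem_factorIdeal_of_bounded X hX) hf
  obtain ⟨N, hN, b, hb⟩ := exists_comp_ne_zero_of_target (id_mem_factorIdeal_of_bounded Y hY) ha
  simp only [iSup_apply, iSup_Prop_eq] at hM hN
  obtain ⟨e, i, j, hi, hij, hj, ⟨u⟩⟩ := hM
  obtain ⟨e', i', j', hi', hij', hj', ⟨u'⟩⟩ := hN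
  refine ⟨i, j, i', j', e, e', ⟨hi, hij, hj⟩, ⟨hi', hij', hj'⟩, u.hom ≫ a, b ≫ u'.inv, ?_⟩
  intro h
  refine hb ?_
  rw [← cancel_epi u.hom, ← cancel_mono u'.inv, Limits.comp_zero, Limits.zero_comp]
  simpa using h

lemma exists_map_shift {X Y : ModA k n} (e : ℤ)
    (f : ((singleFunctor (ModA k n) 0).obj X)⟦e⟧ ⟶ ((singleFunctor (ModA k n) 0).obj Y)⟦e⟧) :
    ∃ g : X ⟶ Y, f = ((singleFunctor (ModA k n) 0).map g)⟦e⟧' := by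
  obtain ⟨f, rfl⟩ := (shiftFunctor _ e).map_surjective f
  obtain ⟨f, rfl⟩ := (singleFunctor _ 0).map_surjective f
  exact ⟨f, rfl⟩

/-- If `Ext¹(M_{ij}, M_{i'j'}) ≠ 0`, then `i' < i ≤ j' + 1 ≤ j`. -/
lemma lt_of_ext_ne_zero {i j i' j' : ℕ} (hi : 1 ≤ i) (hij : i ≤ j) (hj : j ≤ n) (hi' : 1 ≤ i')
    {f : single k n i j ⟶ (single k n i' j')⟦(1 : ℤ)⟧} (hf : f ≠ 0) :
    i' < i ∧ i ≤ j' + 1 ∧ j' < j := by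
  have hL := singleFunctor_shift_isLE (intervalModule k n i' j') 1
  have hP : ∀ (j : ℕ) (_ : 1 ≤ j) (_ : j ≤ n)
      (f : single k n 1 j ⟶ (single k n i' j')⟦(1 : ℤ)⟧), f = 0 := by
    intro j h₁ h₂ f
    have := projective_interval (k := k) h₁ h₂
    exact hom_eq_zero_of_projective_of_isLE (m := -1) (by norm_num) f
  obtain ⟨j, rfl⟩ : ∃ j', j = j' + 1 := ⟨j - 1, by omega⟩
  rcases hi.eq_or_lt with rfl | hi
  · exact absurd (hP _ hij hj f) hf
  obtain ⟨i, rfl⟩ : ∃ i', i = i' + 1 := ⟨i - 1, by omega⟩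
  obtain ⟨δ, hδ, hδ', hδ''⟩ := exists_connecting (k := k) (n := n) (i := i) (j := j) (by omega)
  obtain ⟨g, rfl⟩ := hδ _ f (hP _ (by omega) hj _)
  obtain ⟨g, rfl⟩ := exists_map_shift 1 g
  have hg : g ≠ 0 := by
    rintro rfl
    exact hf (by rw [Functor.map_zero, Functor.map_zero, Limits.comp_zero])
  obtain ⟨h₁, h₂, h₃⟩ := le_of_interval_hom_ne_zero hi' (by omega) (by omega) (by omega) hg
  refine ⟨by omega, by omega, ?_⟩
  -- Otherwise g extends along M_{1i} ⟶ M_{1,j+1}, and δ followed by the shift of this inclusion is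
  -- zero, so f would vanish.
  by_contra! h₄
  obtain ⟨g', hg'⟩ := exists_extension (k := k) (n := n) (i := i) (j := j + 1) (i' := i')
    (j' := j') (by omega) (by omega) hj h₄ g
  refine hf ?_
  rw [← hg', Functor.map_comp, Functor.map_comp]
  rw [reassoc_of% hδ', Limits.zero_comp]

/-- If `i' < i ≤ j' + 1 ≤ j`, then `Ext¹(M_{ij}, M_{i'j'}) ≠ 0`. -/
lemma exists_ext_ne_zero {i j i' j' : ℕ} (hj : j ≤ n) (hi' : 1 ≤ i') (h₁ : i' < i)
    (h₂ : i ≤ j' + 1) (h₃ : j' < j) :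
    ∃ f : single k n i j ⟶ (single k n i' j')⟦(1 : ℤ)⟧, f ≠ 0 := by
  obtain ⟨j, rfl⟩ : ∃ j', j = j' + 1 := ⟨j - 1, by omega⟩
  obtain ⟨i, rfl⟩ : ∃ i', i = i' + 1 := ⟨i - 1, by omega⟩
  obtain ⟨δ, hδ, hδ', hδ''⟩ := exists_connecting (k := k) (n := n) (i := i) (j := j) (by omega)
  -- If this composite were zero, the canonical map M_{1i} ⟶ M_{i'j'} would factor through
  -- M_{1,j+1}, which has no nonzero map to M_{i'j'} because j' < j + 1.
  refine ⟨δ ≫ ((singleFunctor _ 0).map (intervalHom k n hi' (show i ≤ j' by omega)))⟦(1 : ℤ)⟧',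
    fun h => ?_⟩
  obtain ⟨q, hq⟩ := hδ'' _ _ h
  obtain ⟨q, rfl⟩ := exists_map_shift 1 q
  have hq₀ : q = 0 := by
    by_contra hne
    have := le_of_interval_hom_ne_zero hi' (by omega) (by omega) hj hne
    omega
  rw [hq₀, Functor.map_zero, Functor.map_zero, Limits.comp_zero] at hq
  refine intervalHom_ne_zero (k := k) (n := n) hi' (show i ≤ j' by omega) (by omega) (by omega)
    (by omega) ((singleFunctor _ 0).map_injective ((shiftFunctor _ (1 : ℤ)).map_injective ?_))
  rw [hq, Functor.map_zero, Functor.map_zero]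

end ModA

/-! ### Central charges and phases -/

namespace StabilityCondition

variable {C : Type u} [Category.{v} C] [Preadditive C] [HasZeroObject C] [HasShift C ℤ]
  [∀ n : ℤ, (shiftFunctor C n).Additive] [Pretriangulated C] (σ : StabilityCondition C)

lemma Z_eq_add {T : Triangle C} (hT : T ∈ distTriang C) :
    σ.Z (classOf T.obj₂) = σ.Z (classOf T.obj₁) + σ.Z (classOf T.obj₃) := by
  have h : classOf T.obj₂ - classOf T.obj₁ - classOf T.obj₃ = 0 :=
    (QuotientAddGroup.eq_zero_iff _).mpr (AddSubgroup.subset_closure ⟨T, hT, rfl⟩)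
  rw [← map_add, ← sub_eq_zero, ← map_sub, ← sub_sub, h, map_zero]

lemma phase_le_of_ne_zero {φ₁ φ₂ : ℝ} {X Y : C} (hX : σ.P φ₁ X) (hY : σ.P φ₂ Y) {f : X ⟶ Y}
    (hf : f ≠ 0) : φ₁ ≤ φ₂ := by
  by_contra! h
  exact hf (σ.hom_eq_zero φ₁ φ₂ h X Y hX hY f)

lemma P_shift {φ : ℝ} {X : C} (hX : σ.P φ X) (e : ℤ) : σ.P (φ + e) (X⟦e⟧) := by
  induction e using Int.induction_on with
  | zero =>
    rw [Int.cast_zero, add_zero]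
    exact σ.prop_of_iso φ ((shiftFunctorZero C ℤ).app X).symm hX
  | succ e ih =>
    rw [show φ + ((e : ℤ) + 1 : ℤ) = φ + (e : ℤ) + 1 by push_cast; ring, σ.shift]
    exact ⟨_, ih, ⟨(shiftFunctorAdd C (e : ℤ) 1).app X⟩⟩
  | pred e ih =>
    rw [show φ + (-(e : ℤ) : ℤ) = φ + (-(e : ℤ) - 1 : ℤ) + 1 by push_cast; ring, σ.shift] at ih
    obtain ⟨F, hF, ⟨u⟩⟩ := ih
    refine σ.prop_of_iso _ ?_ hF
    exact (shiftShiftNeg F (1 : ℤ)).symm ≪≫ (shiftFunctor C (-1 : ℤ)).mapIso u.symm ≪≫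
      ((shiftFunctorAdd' C (-(e : ℤ)) (-1) (-(e : ℤ) - 1) (by ring)).app X).symm

end StabilityCondition

/-- A gap in [0, 1] gives an angle in [0, π], which lies in the range of the principal argument. -/
lemma arg_div_of_phases {z w : ℂ} {a b x y : ℝ} (ha : 0 < a) (hb : 0 < b)
    (hz : z = a * Complex.exp (Complex.I * Real.pi * x))
    (hw : w = b * Complex.exp (Complex.I * Real.pi * y)) (h₀ : y ≤ x) (h₁ : x ≤ y + 1) :
    Complex.arg (z / w) = Real.pi * (x - y) := by
  have hb' : (b : ℂ) ≠ 0 := by exact_mod_cast hb.ne'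
  have : z / w = ((a / b : ℝ) : ℂ) * (Complex.cos ((Real.pi * (x - y) : ℝ) : ℂ) +
      Complex.sin ((Real.pi * (x - y) : ℝ) : ℂ) * Complex.I) := by
    rw [← Complex.exp_mul_I, hz, hw, mul_div_mul_comm, ← Complex.exp_sub]
    push_cast
    congr 2
    ring
  rw [this]
  have hπ := Real.pi_pos
  exact Complex.arg_mul_cos_add_sin_mul_I (div_pos ha hb) ⟨by nlinarith, by nlinarith⟩

lemma neg_mul_exp_phase {z : ℂ} {a x : ℝ} (hz : z = a * Complex.exp (Complex.I * Real.pi * x)) :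
    -z = a * Complex.exp (Complex.I * Real.pi * (x + 1 : ℝ)) := by
  rw [hz]
  push_cast
  rw [mul_add, mul_one, Complex.exp_add, mul_comm Complex.I, Complex.exp_pi_mul_I]
  ring

/-! ### Intervals in the bounded derived category -/

namespace ModA

open DerivedCategory

variable {k : Type u} [Field k] {n : ℕ}

lemma id_interval_ne_zero {i j : ℕ} (hij : i ≤ j) (h₁ : 1 ≤ j) (h₂ : j ≤ n) :
    𝟙 (intervalModule k n i j) ≠ 0 := fun h =>
  intervalHom_ne_zero (k := k) (n := n) (le_refl i) (le_refl j) hij h₁ h₂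
    (by rw [← Category.id_comp (intervalHom _ _ _ _), h, Limits.zero_comp])

variable [HasDerivedCategory.{w} (ModA k n)]

variable (k n) in
/-- The interval module `M_{ij}` in the bounded derived category. -/
noncomputable abbrev bounded (i j : ℕ) : DbA k n :=
  BoundedDerivedCategory.ofObj (intervalModule k n i j)

lemma exists_distTriang_bounded {i m j : ℕ} (h₁ : i ≤ m + 1) (h₂ : m ≤ j) :
    ∃ T ∈ distTriang (DbA k n), T.obj₁ = bounded k n i m ∧ T.obj₂ = bounded k n i j ∧
      T.obj₃ = bounded k n (m + 1) j := by
  have hT := (intervalShortComplex_shortExact (k := k) (n := n) h₁ h₂).singleTriangle_distinguished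
  let F := (TStructure.t (C := ModA k n)).bounded.ι
  let T : Triangle (DbA k n) := Triangle.mk (X := bounded k n i m) (Y := bounded k n i j)
    (Z := bounded k n (m + 1) j)
    (ObjectProperty.homMk ((singleFunctor _ 0).map (intervalHom k n le_rfl h₂)))
    (ObjectProperty.homMk ((singleFunctor _ 0).map (intervalHom k n h₁ le_rfl)))
    (ObjectProperty.homMk ((intervalShortComplex_shortExact (k := k) (n := n) h₁ h₂).singleδ ≫
      (F.commShiftIso (1 : ℤ)).inv.app (bounded k n i m)))
  refine ⟨T, ?_, rfl, rfl, rfl⟩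
  refine isomorphic_distinguished _ hT (F.mapTriangle.obj T)
    (Triangle.isoMk _ _ (Iso.refl _) (Iso.refl _) (Iso.refl _) ?_ ?_ ?_)
  · exact (Category.comp_id _).trans (Category.id_comp _).symm
  · exact (Category.comp_id _).trans (Category.id_comp _).symm
  · refine Eq.trans ?_ (Category.id_comp _).symm
    refine (congrArg _ (CategoryTheory.Functor.map_id _ _)).trans ((Category.comp_id _).trans ?_)
    exact (Category.assoc _ _ _).trans
      ((congrArg _ ((F.commShiftIso (1 : ℤ)).inv_hom_id_app (bounded k n i m))).trans
        (Category.comp_id _))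

lemma Z_bounded_add (σ : StabilityCondition (DbA k n)) {i m j : ℕ} (h₁ : i ≤ m + 1) (h₂ : m ≤ j) :
    σ.Z (classOf (bounded k n i j)) =
      σ.Z (classOf (bounded k n i m)) + σ.Z (classOf (bounded k n (m + 1) j)) := by
  obtain ⟨T, hT, e₁, e₂, e₃⟩ := exists_distTriang_bounded (k := k) (n := n) h₁ h₂
  rw [← e₁, ← e₂, ← e₃, σ.Z_eq_add hT]

lemma exists_map_bounded {X Y : ModA k n} (f : (BoundedDerivedCategory.ofObj X : DbA k n) ⟶
    BoundedDerivedCategory.ofObj Y) :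
    ∃ g : X ⟶ Y, f = ObjectProperty.homMk ((singleFunctor _ 0).map g) := by
  obtain ⟨g, hg⟩ := (singleFunctor _ 0).map_surjective f.hom
  exact ⟨g, ObjectProperty.hom_ext _ hg.symm⟩

/-- A decomposition yields an idempotent endomorphism, which comes from the module and is therefore
0 or 1; one of the two summands vanishes accordingly. -/
lemma indecomposable_bounded {i j : ℕ} (hij : i ≤ j) (h₁ : 1 ≤ j) (h₂ : j ≤ n) :
    Indecomposable (bounded k n i j) := by
  refine ⟨fun h => ?_, fun Y Z e => ?_⟩
  · have h₀ : 𝟙 (bounded k n i j) = 0 := (IsZero.iff_id_eq_zero _).mp h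
    refine id_interval_ne_zero (k := k) hij h₁ h₂ ((singleFunctor (ModA k n) 0).map_injective ?_)
    rw [CategoryTheory.Functor.map_id, Functor.map_zero]
    exact congrArg (fun f => f.hom) h₀
  · obtain ⟨g, hg⟩ := exists_map_bounded (e.hom ≫ biprod.fst ≫ biprod.inl ≫ e.inv)
    have hgg : g ≫ g = g := by
      apply (singleFunctor (ModA k n) 0).map_injective
      rw [Functor.map_comp]
      have h : (e.hom ≫ biprod.fst ≫ biprod.inl ≫ e.inv) ≫
          (e.hom ≫ biprod.fst ≫ biprod.inl ≫ e.inv) =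
          e.hom ≫ biprod.fst ≫ biprod.inl ≫ e.inv := by simp
      rw [hg] at h
      exact congrArg (fun f => f.hom) h
    rcases idempotent_interval h₁ h₂ hij g hgg with rfl | rfl
    · left
      have h : e.hom ≫ biprod.fst ≫ biprod.inl ≫ e.inv = 0 := by
        rw [hg, Functor.map_zero]
        rfl
      rw [IsZero.iff_id_eq_zero]
      have := congrArg (fun f => biprod.inl ≫ e.inv ≫ f ≫ e.hom ≫ biprod.fst) h
      simpa using this
    · right
      have h : e.hom ≫ biprod.fst ≫ biprod.inl ≫ e.inv = 𝟙 _ := by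
        rw [hg]
        exact ObjectProperty.hom_ext _ ((singleFunctor (ModA k n) 0).map_id _)
      rw [IsZero.iff_id_eq_zero]
      have := congrArg (fun f => biprod.inr ≫ e.inv ≫ f ≫ e.hom ≫ biprod.snd) h
      simpa using this.symm

lemma exists_phase {σ : StabilityCondition (DbA k n)} (hσ : σ.IsTotallyStable) {i j : ℕ}
    (hij : i ≤ j) (h₁ : 1 ≤ j) (h₂ : j ≤ n) : ∃ φ : ℝ, σ.P φ (bounded k n i j) := by
  obtain ⟨φ, h, _⟩ := hσ _ (indecomposable_bounded hij h₁ h₂)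
  exact ⟨φ, h⟩

variable (k n) in
/-- The shifts of interval modules in the bounded derived category and in the derived category. -/
noncomputable def boundedShiftIso (i j : ℕ) (e : ℤ) :
    ((bounded k n i j)⟦e⟧).obj ≅ (single k n i j)⟦e⟧ :=
  ((TStructure.t (C := ModA k n)).bounded.ι.commShiftIso e).app (bounded k n i j)

/-- Negative degrees vanish by the t-structure, degrees at least 2 by heredity. -/
lemma ext_eq_zero {i j i' j' : ℕ} (hi : 1 ≤ i) (hij : i ≤ j) (hj : j ≤ n) {d : ℤ}
    (hd : d ≠ 0) (hd' : d ≠ 1) (f : single k n i j ⟶ (single k n i' j')⟦d⟧) : f = 0 := by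
  rcases lt_or_ge d 0 with h | h
  · have := singleFunctor_shift_isGE (intervalModule k n i' j') d
    exact TStructure.t.zero f 0 (-d) (by omega)
  · have := singleFunctor_shift_isLE (intervalModule k n i' j') d
    exact single_hom_eq_zero_of_isLE hi hij hj (m := -d) (by omega) f

/-- The degree of a nonzero morphism between shifts of interval modules is `0` or `1`. -/
lemma degree_cases {i j i' j' : ℕ} (h : 1 ≤ i ∧ i ≤ j ∧ j ≤ n) (h' : 1 ≤ i' ∧ i' ≤ j' ∧ j' ≤ n)
    {e e' : ℤ} {f : (single k n i j)⟦e⟧ ⟶ (single k n i' j')⟦e'⟧} (hf : f ≠ 0) :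
    (e' = e ∧ i ≤ i' ∧ i' ≤ j ∧ j ≤ j') ∨ (e' = e + 1 ∧ i' < i ∧ i ≤ j' + 1 ∧ j' < j) := by
  obtain ⟨d, hd, g, hg⟩ : ∃ (d : ℤ) (_ : d = e' - e) (g : single k n i j ⟶
      (single k n i' j')⟦d⟧), g ≠ 0 := by
    obtain ⟨g, hg⟩ := not_forall.mp (mt (fun H => eq_zero_of_shift_source e H f) hf)
    refine ⟨_, rfl, g ≫ ((shiftFunctorAdd' (DerivedCategory (ModA k n)) e' (-e) (e' - e)
      (by ring)).app (single k n i' j')).inv, fun H => hg ?_⟩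
    rw [← cancel_mono ((shiftFunctorAdd' (DerivedCategory (ModA k n)) e' (-e) (e' - e)
      (by ring)).app (single k n i' j')).inv, H, Limits.zero_comp]
  by_cases h₀ : d = 0
  · subst h₀
    obtain ⟨g', hg'⟩ := (singleFunctor _ 0).map_surjective
      (g ≫ ((shiftFunctorZero (DerivedCategory (ModA k n)) ℤ).app (single k n i' j')).hom)
    refine .inl ⟨by omega, le_of_interval_hom_ne_zero (f := g') h'.1 h.2.1 (by omega) h.2.2 ?_⟩
    rintro rfl
    rw [Functor.map_zero] at hg'
    exact hg (by
      rw [← cancel_mono ((shiftFunctorZero (DerivedCategory (ModA k n)) ℤ).app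
        (single k n i' j')).hom, ← hg', Limits.zero_comp])
  · by_cases h₁ : d = 1
    · subst h₁
      exact .inr ⟨by omega, lt_of_ext_ne_zero h.1 h.2.1 h.2.2 h'.1 hg⟩
    · exact absurd (ext_eq_zero h.1 h.2.1 h.2.2 h₀ h₁ g) hg

/-! ### Phases of intervals and the Serre functor -/

section Phases

variable {σ : StabilityCondition (DbA k n)} {φ : ℕ → ℕ → ℝ}

/-- `φ i j` is the phase of `M_{ij}`. -/
def IsPhase (σ : StabilityCondition (DbA k n)) (φ : ℕ → ℕ → ℝ) : Prop :=
  ∀ i j : ℕ, 1 ≤ i → i ≤ j → j ≤ n → σ.P (φ i j) (bounded k n i j)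

variable (n) in
/-- The phase of the image of `M_{ij}` under the Serre functor. -/
def serrePhase (φ : ℕ → ℕ → ℝ) (i j : ℕ) : ℝ :=
  if i = 1 then φ j n else φ (i - 1) (j - 1) + 1

lemma exists_isPhase (hσ : σ.IsTotallyStable) : ∃ φ : ℕ → ℕ → ℝ, IsPhase σ φ := by
  have : ∀ i j : ℕ, ∃ φ : ℝ, 1 ≤ i → i ≤ j → j ≤ n → σ.P φ (bounded k n i j) := by
    intro i j
    by_cases h : 1 ≤ i ∧ i ≤ j ∧ j ≤ n
    · obtain ⟨φ, hφ⟩ := exists_phase hσ h.2.1 (h.1.trans h.2.1) h.2.2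
      exact ⟨φ, fun _ _ _ => hφ⟩
    · exact ⟨0, fun h₁ h₂ h₃ => absurd ⟨h₁, h₂, h₃⟩ h⟩
  choose φ hφ using this
  exact ⟨φ, hφ⟩

lemma exists_hom_bounded_ne_zero {i j i' j' : ℕ} (h₁ : i ≤ i') (h₂ : i' ≤ j) (h₃ : j ≤ j')
    (hj : 1 ≤ j) (hj' : j ≤ n) : ∃ f : bounded k n i j ⟶ bounded k n i' j', f ≠ 0 := by
  refine ⟨ObjectProperty.homMk ((singleFunctor _ 0).map (intervalHom k n h₁ h₃)), fun h => ?_⟩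
  refine intervalHom_ne_zero (k := k) (n := n) h₁ h₃ h₂ hj hj'
    ((singleFunctor (ModA k n) 0).map_injective ?_)
  rw [Functor.map_zero]
  exact congrArg (fun f => f.hom) h

lemma exists_ext_bounded_ne_zero {i j i' j' : ℕ} (hj : j ≤ n) (hi' : 1 ≤ i') (h₁ : i' < i)
    (h₂ : i ≤ j' + 1) (h₃ : j' < j) :
    ∃ f : bounded k n i j ⟶ (bounded k n i' j')⟦(1 : ℤ)⟧, f ≠ 0 := by
  obtain ⟨f, hf⟩ := exists_ext_ne_zero (k := k) hj hi' h₁ h₂ h₃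
  refine ⟨ObjectProperty.homMk (f ≫ (boundedShiftIso k n i' j' 1).inv), fun h => hf ?_⟩
  rw [← cancel_mono (boundedShiftIso k n i' j' 1).inv, Limits.zero_comp]
  exact congrArg (fun f => f.hom) h

lemma IsPhase.le_of_hom (hφ : IsPhase σ φ) {i j i' j' : ℕ} (hi : 1 ≤ i) (h₁ : i ≤ i')
    (h₂ : i' ≤ j) (h₃ : j ≤ j') (hj' : j' ≤ n) : φ i j ≤ φ i' j' := by
  obtain ⟨f, hf⟩ := exists_hom_bounded_ne_zero (k := k) h₁ h₂ h₃ (by omega) (h₃.trans hj')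
  exact σ.phase_le_of_ne_zero (hφ _ _ hi (h₁.trans h₂) (h₃.trans hj'))
    (hφ _ _ (hi.trans h₁) (h₂.trans h₃) hj') hf

lemma IsPhase.shift (hφ : IsPhase σ φ) {i j : ℕ} (h₁ : 1 ≤ i) (h₂ : i ≤ j) (h₃ : j ≤ n) :
    σ.P (φ i j + 1) ((bounded k n i j)⟦(1 : ℤ)⟧) := by
  simpa using σ.P_shift (hφ _ _ h₁ h₂ h₃) 1

lemma IsPhase.le_of_ext (hφ : IsPhase σ φ) {i j i' j' : ℕ} (hi' : 1 ≤ i') (h₁ : i' < i)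
    (h₂ : i ≤ j' + 1) (h₃ : j' < j) (hj : j ≤ n) (hi'j' : i' ≤ j') (hij : i ≤ j) :
    φ i j ≤ φ i' j' + 1 := by
  obtain ⟨f, hf⟩ := exists_ext_bounded_ne_zero (k := k) hj hi' h₁ h₂ h₃
  exact σ.phase_le_of_ne_zero (hφ _ _ (by omega) hij hj)
    (hφ.shift hi' hi'j' (h₃.le.trans hj)) hf

lemma IsPhase.le_serrePhase (hφ : IsPhase σ φ) {i j : ℕ} (hi : 1 ≤ i) (hij : i ≤ j) (hj : j ≤ n) :
    φ i j ≤ serrePhase n φ i j := by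
  unfold serrePhase
  split_ifs with h
  · exact hφ.le_of_hom hi hij le_rfl hj le_rfl
  · exact hφ.le_of_ext (by omega) (by omega) (by omega) (by omega) hj (by omega) hij

/-- Phases increase along chains of nonzero maps from S M to M[1]. For i ≥ 2 the chain is the shift
of M_{i-1,j-1} ⟶ M_{i-1,j} ⟶ M_{ij}. For i = 1 it is M_{jn} ⟶ M_{j+1,n} ⟶ M_{1j}[1] if j < n, and
M_{nn} ⟶ M_{1,n-1}[1] ⟶ M_{1n}[1] if 1 < j = n; for j = n = 1, S M = M. -/
lemma IsPhase.serrePhase_le (hφ : IsPhase σ φ) {i j : ℕ} (hi : 1 ≤ i) (hij : i ≤ j) (hj : j ≤ n) :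
    serrePhase n φ i j ≤ φ i j + 1 := by
  unfold serrePhase
  split_ifs with h
  · subst h
    rcases hj.eq_or_lt with rfl | hj'
    · rcases hij.eq_or_lt with rfl | hij'
      · linarith
      · have h₁ := hφ.le_of_ext (i := j) (j := j) (i' := 1) (j' := j - 1) le_rfl hij' (by omega)
          (by omega) le_rfl (by omega) le_rfl
        have h₂ := hφ.le_of_hom (i := 1) (j := j - 1) (i' := 1) (j' := j) le_rfl le_rfl (by omega)
          (by omega) le_rfl
        linarith
    · have h₁ := hφ.le_of_hom (i := j) (j := n) (i' := j + 1) (j' := n) hij (by omega) hj' le_rfl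
        le_rfl
      have h₂ := hφ.le_of_ext (i := j + 1) (j := n) (i' := 1) (j' := j) le_rfl (by omega) le_rfl
        hj' le_rfl hij hj'
      linarith
  · have h₁ := hφ.le_of_hom (i := i - 1) (j := j - 1) (i' := i - 1) (j' := j) (by omega) le_rfl
      (by omega) (by omega) hj
    have h₂ := hφ.le_of_hom (i := i - 1) (j := j) (i' := i) (j' := j) (by omega) (by omega)
      hij le_rfl hj
    linarith

/-- The phase gap of a nonzero morphism is bounded by that of a morphism from an indecomposable
object to its image under the Serre functor. -/
lemma IsPhase.exists_sub_le (hφ : IsPhase σ φ) {X Y : DbA k n} {φ₁ φ₂ : ℝ} (hX : σ.P φ₁ X)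
    (hY : σ.P φ₂ Y) {f : X ⟶ Y} (hf : f ≠ 0) :
    ∃ i j : ℕ, 1 ≤ i ∧ i ≤ j ∧ j ≤ n ∧ φ₂ - φ₁ ≤ serrePhase n φ i j - φ i j := by
  obtain ⟨i, j, i', j', e, e', h, h', a, b, hab⟩ := exists_shifted_interval_comp_ne_zero
    X.property Y.property (f := f.hom) (fun H => hf (ObjectProperty.hom_ext _ H))
  refine ⟨i, j, h.1, h.2.1, h.2.2, ?_⟩
  have h₁ : φ i j + e ≤ φ₁ := by
    refine σ.phase_le_of_ne_zero (σ.P_shift (hφ _ _ h.1 h.2.1 h.2.2) e) hX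
      (f := ObjectProperty.homMk ((boundedShiftIso k n i j e).hom ≫ a)) fun H => hab ?_
    have H' : (boundedShiftIso k n i j e).hom ≫ a = 0 := congrArg (fun f => f.hom) H
    rw [(cancel_epi (boundedShiftIso k n i j e).hom).mp (H'.trans Limits.comp_zero.symm),
      Limits.zero_comp]
  have h₂ : φ₂ ≤ φ i' j' + e' := by
    refine σ.phase_le_of_ne_zero hY (σ.P_shift (hφ _ _ h'.1 h'.2.1 h'.2.2) e')
      (f := ObjectProperty.homMk (b ≫ (boundedShiftIso k n i' j' e').inv)) fun H => hab ?_
    have H' : b ≫ (boundedShiftIso k n i' j' e').inv = 0 := congrArg (fun f => f.hom) H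
    rw [(cancel_mono (boundedShiftIso k n i' j' e').inv).mp (H'.trans Limits.zero_comp.symm),
      Limits.comp_zero, Limits.comp_zero]
  -- Serre duality by cases: each nonzero M[e] ⟶ N[e'] has a counterpart N[e'] ⟶ (S M)[e], a Hom or
  -- an Ext¹ of intervals.
  have h₃ : φ i' j' + e' - e ≤ serrePhase n φ i j := by
    unfold serrePhase
    rcases degree_cases h h' hab with ⟨rfl, h₃, h₄, h₅⟩ | ⟨rfl, h₃, h₄, h₅⟩
    · rw [add_sub_cancel_right]
      split_ifs with hi
      · exact hφ.le_of_hom h'.1 h₄ h₅ h'.2.2 le_rfl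
      · exact hφ.le_of_ext (by omega) (by omega) (by omega) (by omega) h'.2.2 (by omega) h'.2.1
    · rw [if_neg (by omega)]
      have := hφ.le_of_hom (i := i') (j := j') (i' := i - 1) (j' := j - 1) h'.1 (by omega)
        (by omega) (by omega) (by omega)
      push_cast
      linarith
  linarith

lemma IsPhase.serre_mem (hφ : IsPhase σ φ) {i j : ℕ} (hi : 1 ≤ i) (hij : i ≤ j) (hj : j ≤ n) :
    ∃ (φ₁ φ₂ : ℝ) (E₁ E₂ : DbA k n) (f : E₁ ⟶ E₂), σ.P φ₁ E₁ ∧ σ.P φ₂ E₂ ∧ f ≠ 0 ∧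
      ((serrePhase n φ i j - φ i j : ℝ) : EReal) = ((φ₂ - φ₁ : ℝ) : EReal) := by
  unfold serrePhase
  split_ifs with h
  · obtain ⟨f, hf⟩ := exists_hom_bounded_ne_zero (k := k) hij (le_refl j) hj (hi.trans hij) hj
    exact ⟨_, _, _, _, f, hφ _ _ hi hij hj, hφ _ _ (hi.trans hij) hj le_rfl, hf, rfl⟩
  · obtain ⟨f, hf⟩ := exists_ext_bounded_ne_zero (k := k) (i := i) (i' := i - 1) (j' := j - 1) hj
      (by omega) (by omega) (by omega) (by omega)
    exact ⟨_, _, _, _, f, hφ _ _ hi hij hj, hφ.shift (by omega) (by omega) (by omega), hf, rfl⟩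

end Phases

/-! ### Angles of the polygon as phase gaps -/

section Polygon

variable {σ : StabilityCondition (DbA k n)} {φ : ℕ → ℕ → ℝ}

lemma IsPhase.Z_eq (hφ : IsPhase σ φ) {i j : ℕ} (h₁ : 1 ≤ i) (h₂ : i ≤ j) (h₃ : j ≤ n) :
    ∃ m : ℝ, 0 < m ∧ σ.Z (classOf (bounded k n i j)) =
      m * Complex.exp (Complex.I * Real.pi * φ i j) :=
  σ.central_charge _ _ (hφ _ _ h₁ h₂ h₃) (indecomposable_bounded h₂ (h₁.trans h₂) h₃).1

lemma polygonVertex_sub (σ : StabilityCondition (DbA k n)) {i j : ℕ} (hij : i ≤ j) (hj : j ≤ n) :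
    polygonVertex σ j - polygonVertex σ i = σ.Z (classOf (bounded k n (i + 1) j)) /
      σ.Z (classOf (bounded k n 1 1)) := by
  rw [polygonVertex, polygonVertex, if_pos hj, if_pos (hij.trans hj), ← sub_div,
    Z_bounded_add σ (Nat.le_add_left 1 i) hij, add_sub_cancel_left]

lemma polygonVertex_zero (σ : StabilityCondition (DbA k n)) : polygonVertex σ 0 = 0 := by
  -- The triangle with m = j = 0 reads Z(M_{10}) = Z(M_{10}) + Z(M_{10}).
  have h := Z_bounded_add σ (Nat.le_add_left 1 0) (le_refl 0)
  rw [left_eq_add] at h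
  rw [polygonVertex, if_pos (Nat.zero_le n)]
  exact (congrArg (· / _) h).trans (zero_div _)

lemma polygonVertex_succ (σ : StabilityCondition (DbA k n)) : polygonVertex σ (n + 1) = 0 :=
  if_neg (by omega)

/-- Up to the factor Z(M_{11}), the vector P_jP_i is -Z(M_{i+1,j}) = Z(M_{i+1,j}[1]), and
M_{i+1,j}[1] = S M_{i+2,j+1}. -/
lemma IsPhase.argDiff_eq (hφ : IsPhase σ φ) (hn : 1 ≤ n) {i j : ℕ} (hij : i < j) (hj : j < n) :
    argDiff (polygonVertex σ i - polygonVertex σ j)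
      (polygonVertex σ (j + 1) - polygonVertex σ (i + 1)) =
      Real.pi * (serrePhase n φ (i + 2) (j + 1) - φ (i + 2) (j + 1)) := by
  have h₁ := hφ.le_serrePhase (i := i + 2) (j := j + 1) (by omega) (by omega) hj
  have h₂ := hφ.serrePhase_le (i := i + 2) (j := j + 1) (by omega) (by omega) hj
  rw [serrePhase, if_neg (by omega)] at h₁ h₂ ⊢
  obtain ⟨a, ha, hza⟩ := hφ.Z_eq (i := i + 1) (j := j) (by omega) hij hj.le
  obtain ⟨b, hb, hzb⟩ := hφ.Z_eq (i := i + 2) (j := j + 1) (by omega) (by omega) hj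
  obtain ⟨c, hc, hzc⟩ := hφ.Z_eq (i := 1) (j := 1) le_rfl le_rfl hn
  have hc₀ : σ.Z (classOf (bounded k n 1 1)) ≠ 0 := by
    rw [hzc]
    exact mul_ne_zero (by exact_mod_cast hc.ne') (Complex.exp_ne_zero _)
  rw [argDiff, ← neg_sub, polygonVertex_sub σ hij.le hj.le, polygonVertex_sub σ (by omega) hj,
    ← neg_div, div_div_div_cancel_right₀ hc₀]
  exact arg_div_of_phases ha hb (neg_mul_exp_phase hza) hzb h₁ h₂

lemma IsPhase.argDiff_last_eq (hφ : IsPhase σ φ) (hn : 1 ≤ n) {i : ℕ} (hi : i < n) :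
    argDiff (polygonVertex σ i - polygonVertex σ n)
      (polygonVertex σ (n + 1) - polygonVertex σ (i + 1)) =
      Real.pi * (serrePhase n φ 1 (i + 1) - φ 1 (i + 1)) := by
  have h₁ := hφ.le_serrePhase (i := 1) (j := i + 1) (by omega) (by omega) hi
  have h₂ := hφ.serrePhase_le (i := 1) (j := i + 1) (by omega) (by omega) hi
  rw [serrePhase, if_pos rfl] at h₁ h₂ ⊢
  obtain ⟨a, ha, hza⟩ := hφ.Z_eq (i := i + 1) (j := n) (by omega) hi le_rfl
  obtain ⟨b, hb, hzb⟩ := hφ.Z_eq (i := 1) (j := i + 1) (by omega) (by omega) hi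
  obtain ⟨c, hc, hzc⟩ := hφ.Z_eq (i := 1) (j := 1) le_rfl le_rfl hn
  have hc₀ : σ.Z (classOf (bounded k n 1 1)) ≠ 0 := by
    rw [hzc]
    exact mul_ne_zero (by exact_mod_cast hc.ne') (Complex.exp_ne_zero _)
  -- With P_{n+1} = P_0 both vectors are negatives of central charges, so the signs cancel and no
  -- shift appears, in accordance with S M_{1,i+1} = M_{i+1,n}.
  rw [argDiff, polygonVertex_succ, ← polygonVertex_zero σ, ← neg_sub,
    ← neg_sub (polygonVertex σ (i + 1)), polygonVertex_sub σ hi.le le_rfl,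
    polygonVertex_sub σ (Nat.zero_le _) hi, neg_div_neg_eq, div_div_div_cancel_right₀ hc₀]
  exact arg_div_of_phases ha hb hza hzb h₁ h₂

/-- The pairs match by (i, j) ↦ (i + 2, j + 1) for j < n, giving the intervals that do not start at
1, and (i, n) ↦ (1, i + 1), giving the projectives. -/
lemma IsPhase.angle_set_eq (hφ : IsPhase σ φ) (hn : 1 ≤ n) :
    {θ : ℝ | ∃ i j : ℕ, i < j ∧ j ≤ n ∧
        θ = argDiff (polygonVertex σ i - polygonVertex σ j)
          (polygonVertex σ (j + 1) - polygonVertex σ (i + 1))} =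
      {θ : ℝ | ∃ i j : ℕ, 1 ≤ i ∧ i ≤ j ∧ j ≤ n ∧
        θ = Real.pi * (serrePhase n φ i j - φ i j)} := by
  ext θ
  constructor
  · rintro ⟨i, j, hij, hj, rfl⟩
    rcases hj.eq_or_lt with rfl | hj
    · exact ⟨1, i + 1, le_rfl, by omega, hij, hφ.argDiff_last_eq hn hij⟩
    · exact ⟨i + 2, j + 1, by omega, by omega, hj, hφ.argDiff_eq hn hij hj⟩
  · rintro ⟨i, j, hi, hij, hj, rfl⟩
    rcases hi.eq_or_lt with rfl | hi
    · obtain ⟨j, rfl⟩ : ∃ j', j = j' + 1 := ⟨j - 1, by omega⟩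
      exact ⟨j, n, hj, le_rfl, (hφ.argDiff_last_eq hn hj).symm⟩
    · obtain ⟨i, rfl⟩ : ∃ i', i = i' + 2 := ⟨i - 2, by omega⟩
      obtain ⟨j, rfl⟩ : ∃ j', j = j' + 1 := ⟨j - 1, by omega⟩
      exact ⟨i, j, by omega, by omega, (hφ.argDiff_eq hn (by omega) hj).symm⟩

end Polygon

end ModA

theorem proposition3p6 {k : Type u} [Field k] {n : ℕ} (hn : 1 ≤ n)
    [HasDerivedCategory.{w} (ModA k n)]
    (σ : StabilityCondition (DbA k n)) (hσ : σ.IsTotallyStable) :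
    ∃ m : ℝ,
      IsGreatest {θ : ℝ | ∃ i j : ℕ, i < j ∧ j ≤ n ∧
        θ = argDiff (polygonVertex σ i - polygonVertex σ j)
          (polygonVertex σ (j + 1) - polygonVertex σ (i + 1))} m ∧
      σ.gldim = ((1 / Real.pi * m : ℝ) : EReal) := by
  obtain ⟨φ, hφ⟩ := ModA.exists_isPhase hσ
  rw [hφ.angle_set_eq hn]
  -- There are finitely many intervals, so some M_{ab} has the largest gap; the same pair then
  -- serves for the angles and for the supremum.
  obtain ⟨⟨a, b⟩, hab, hmax⟩ := Finset.exists_max_image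
    ((Finset.range (n + 1) ×ˢ Finset.range (n + 1)).filter
      fun p : ℕ × ℕ => 1 ≤ p.1 ∧ p.1 ≤ p.2 ∧ p.2 ≤ n)
    (fun p => ModA.serrePhase n φ p.1 p.2 - φ p.1 p.2)
    ⟨(1, 1), by simp; omega⟩
  obtain ⟨-, ha, hab, hb⟩ := Finset.mem_filter.mp hab
  have hmax' : ∀ i j : ℕ, 1 ≤ i → i ≤ j → j ≤ n →
      ModA.serrePhase n φ i j - φ i j ≤ ModA.serrePhase n φ a b - φ a b := fun i j h₁ h₂ h₃ =>
    hmax (i, j) (by simp; omega)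
  refine ⟨Real.pi * (ModA.serrePhase n φ a b - φ a b), ⟨⟨a, b, ha, hab, hb, rfl⟩, ?_⟩, ?_⟩
  · rintro _ ⟨i, j, h₁, h₂, h₃, rfl⟩
    exact mul_le_mul_of_nonneg_left (hmax' i j h₁ h₂ h₃) Real.pi_pos.le
  · rw [← mul_assoc, one_div, inv_mul_cancel₀ Real.pi_ne_zero, one_mul]
    refine le_antisymm (sSup_le ?_) (le_sSup (hφ.serre_mem ha hab hb))
    rintro _ ⟨φ₁, φ₂, X, Y, f, hX, hY, hf, rfl⟩
    obtain ⟨i, j, h₁, h₂, h₃, h⟩ := hφ.exists_sub_le hX hY hf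
    exact EReal.coe_le_coe_iff.mpr (h.trans (hmax' i j h₁ h₂ h₃))
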